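/- Let $m,n\ge 1$. For $p,q\ge 0$ consider a $(2p+1)\times(2q+1)$ chessboard ($2p+1$ rows, $2q+1$ columns) with black corners. The Aztec rectangle graph $AR_{p,q}$ has the white squares as vertices, the odd Aztec rectangle graph $O_{p,q}$ has the black squares as vertices; in both, two vertices are adjacent if and only if the corresponding squares share a corner. Let $T_{m,n}$ be the toroidal Aztec rectangle obtained from $AR_{m,n}$ by identifying corresponding vertices along its top and bottom boundaries and along its left and right boundaries. An odd Aztec window of shape $O_{p,q}$ in $T_{m,n}$ is the vertex set of a copy of $O_{p,q}$ laid down by translation (with given center) so that it is an induced subgraph of $T_{m,n}$. Fix a proper coloring of the vertices of $T_{m,n}$ with the colors black and white; a window is white-placed (respectively black-placed) if the majority of its vertices are white (respectively black). $\mathrm{M}(G)$ denotes the number of perfect matchings of the graph $G$. Let $k\ge0$, $l\ge 1$, $s\ge 0$ be integers. Let $O_1,\dots,O_s$ be white-placed odd Aztec windows of shape $O_{k,l}$ and $O_{s+1},\dots,O_{2s}$ black-placed odd Aztec windows of shape $O_{l,k}$ in $T_{m,n}$, all $2s$ windows being mutually disjoint. If $k=0$ (so that the windows are horizontal and vertical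 diagonal slits), assume also that no white-placed slit crosses a black-placed one, i.e. that the $1\times(2l+1)$ board carrying $O_i$, $i\le s$, and the $(2l+1)\times 1$ board carrying $O_j$, $j>s$, never have a square in common. Assume that $T_{m,n}\setminus O_1\cup\cdots\cup O_{2s}$ has at least one perfect matching. For $i\le s$ let $O_i^{+,-}$ be the odd Aztec window of shape $O_{k+1,l-1}$ with the same center as $O_i$, and for $j>s$ let $O_j^{-,+}$ be the odd Aztec window of shape $O_{l-1,k+1}$ with the same center as $O_j$. Then these are indeed odd Aztec windows in $T_{m,n}$, they are mutually disjoint, and $$ \mathrm{M}(T_{m,n}\setminus O_1\cup\cdots\cup O_s\cup O_{s+1}\cup\cdots\cup O_{2s}) =2^{s(l-k-1)}\,\mathrm{M}(T_{m,n}\setminus O_1^{+,-}\cup\cdots\cup O_s^{+,-}\cup O_{s+1}^{-,+}\cup\cdots\cup O_{2s}^{-,+}). $$ -/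

import Mathlib

namespace AztecWindows

/-- Two unit squares of a chessboard, given by their (row, column) indices, are diagonally adjacent:
they are distinct and share a corner but no side. Same-coloured squares that share a corner are
exactly those related in this way. -/
def ShareCorner (p q : ℕ × ℕ) : Prop :=
  |(p.1 : ℤ) - q.1| = 1 ∧ |(p.2 : ℤ) - q.2| = 1

lemma ShareCorner.symm {p q : ℕ × ℕ} (h : ShareCorner p q) : ShareCorner q p := by
  unfold ShareCorner at *
  rwa [abs_sub_comm (q.1 : ℤ), abs_sub_comm (q.2 : ℤ)]

lemma ShareCorner.irrefl (p : ℕ × ℕ) : ¬ ShareCorner p p := by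
  simp [ShareCorner]

/-- The white squares of the `(2m+1) × (2n+1)` chessboard with black corners
(rows `0, …, 2m`, columns `0, …, 2n`). -/
abbrev WhiteSquare (m n : ℕ) : Type :=
  {p : ℕ × ℕ // p.1 ≤ 2 * m ∧ p.2 ≤ 2 * n ∧ Odd (p.1 + p.2)}

/-- The black squares of the `(2m+1) × (2n+1)` chessboard with black corners. -/
abbrev BlackSquare (m n : ℕ) : Type :=
  {p : ℕ × ℕ // p.1 ≤ 2 * m ∧ p.2 ≤ 2 * n ∧ Even (p.1 + p.2)}

/-- The Aztec rectangle graph `AR_{m,n}` of height `m` and width `n`. -/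
def aztecRectangle (m n : ℕ) : SimpleGraph (WhiteSquare m n) where
  Adj p q := ShareCorner p.1 q.1
  symm := ⟨fun _ _ h => h.symm⟩
  loopless := ⟨fun p h => ShareCorner.irrefl p.1 h⟩

/-- The odd Aztec rectangle graph `O_{k,l}` of height `k` and width `l`. -/
def oddAztecRectangle (k l : ℕ) : SimpleGraph (BlackSquare k l) where
  Adj p q := ShareCorner p.1 q.1
  symm := ⟨fun _ _ h => h.symm⟩
  loopless := ⟨fun p h => ShareCorner.irrefl p.1 h⟩

/-- The squares of the toroidal board with `2m` rows and `2n` columns. -/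
abbrev TorusSquare (m n : ℕ) : Type := ZMod (2 * m) × ZMod (2 * n)

/-- The identification of opposite sides: row `0` with row `2m`, column `0` with column `2n`;
no other two vertices of `AR_{m,n}` are identified. -/
def wrap (m n : ℕ) (p : WhiteSquare m n) : TorusSquare m n :=
  ((p.1.1 : ZMod (2 * m)), (p.1.2 : ZMod (2 * n)))

/-- The vertices of `AR_{m,n}` after identification. -/
abbrev ToroidalVertex (m n : ℕ) : Type := Set.range (wrap m n)

/-- The toroidal Aztec rectangle `T_{m,n}`: the image of `AR_{m,n}` under the identification of
corresponding vertices along its top and bottom, and along its left and right boundaries. -/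
def toroidalAztecRectangle (m n : ℕ) : SimpleGraph (ToroidalVertex m n) :=
  (aztecRectangle m n).map (Set.rangeFactorization (wrap m n))

/-- Where the square `p` of a `(2k+1) × (2l+1)` board goes if the board is laid on the torus with
its central square on `c`. -/
def place {m n : ℕ} (k l : ℕ) (c : TorusSquare m n) (p : ℕ × ℕ) : TorusSquare m n :=
  (c.1 + ((p.1 : ZMod (2 * m)) - k), c.2 + ((p.2 : ZMod (2 * n)) - l))

/-- All squares covered by the `(2k+1) × (2l+1)` board centred at `c`. -/
def board {m n : ℕ} (k l : ℕ) (c : TorusSquare m n) : Set (TorusSquare m n) :=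
  {x | ∃ p : ℕ × ℕ, p.1 ≤ 2 * k ∧ p.2 ≤ 2 * l ∧ x = place k l c p}

/-- The set of vertices of `T_{m,n}` in the hole of shape `O_{k,l}` centred at `c`. -/
def window {m n : ℕ} (k l : ℕ) (c : TorusSquare m n) : Set (ToroidalVertex m n) :=
  {v | ∃ p : BlackSquare k l, (v : TorusSquare m n) = place k l c p.1}

/-- `c` is the centre of a genuine window of shape `O_{k,l}`: laying `O_{k,l}` down with centre `c`
embeds it in `T_{m,n}` as an induced subgraph. -/
def IsWindow {m n : ℕ} (k l : ℕ) (c : TorusSquare m n) : Prop :=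
  ∃ f : oddAztecRectangle k l ↪g toroidalAztecRectangle m n,
    ∀ p : BlackSquare k l, (f p : TorusSquare m n) = place k l c p.1

/-- With respect to a proper 2-colouring (`true` is white, `false` is black), the majority of the
vertices of the hole are white. -/
def WhitePlaced {m n : ℕ} (col : (toroidalAztecRectangle m n).Coloring Bool)
    (H : Set (ToroidalVertex m n)) : Prop :=
  {v ∈ H | col v = false}.ncard < {v ∈ H | col v = true}.ncard

/-- The majority of the vertices of the hole are black. -/
def BlackPlaced {m n : ℕ} (col : (toroidalAztecRectangle m n).Coloring Bool)
    (H : Set (ToroidalVertex m n)) : Prop :=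
  {v ∈ H | col v = true}.ncard < {v ∈ H | col v = false}.ncard

/-- The `2s` holes consisting of one hole of shape `O_{a,b}` centred at each `cW i`, and one hole of
shape `O_{b,a}` centred at each `cB j`. -/
def holes {m n s : ℕ} (a b : ℕ) (cW cB : Fin s → TorusSquare m n) :
    Fin s ⊕ Fin s → Set (ToroidalVertex m n) :=
  Sum.elim (fun i => window a b (cW i)) (fun j => window b a (cB j))

/-- The number of perfect matchings of a (finite) graph. -/
noncomputable def numPerfectMatchings {V : Type*} (G : SimpleGraph V) : ℕ :=
  Nat.card {M : G.Subgraph // M.IsPerfectMatching}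

/-- The number of perfect matchings of `T_{m,n}` with the given holes removed. -/
noncomputable def matchingsWithHoles {m n : ℕ} {ι : Type*}
    (H : ι → Set (ToroidalVertex m n)) : ℕ :=
  numPerfectMatchings ((toroidalAztecRectangle m n).induce (⋃ i, H i)ᶜ)

end AztecWindows

namespace AztecWindows

/-! The proof complements perfect matchings inside the 4-cycles that make up the torus. Let `ε` be
the row parity of the white vertices. Call a square with both coordinates of parity `ε` a cell. The
four vertices on its sides form a 4-cycle: two horizontal ones, which are white, and two vertical
ones, which are black. When `m, n > 1` these cycles partition the edges, and every vertex lies on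
exactly two of them (`isCellGraph_toroidal`).

A perfect matching splits into one matching per cell. Record only which vertices each cell covers. A
pattern arises from 1 matching if it is empty or consists of one horizontal and one vertical vertex,
from 2 if it is full, and from none otherwise. Complementing a pattern therefore preserves
admissibility and changes the weight by a factor that depends only on its number of horizontal
vertices (`CellPattern.two_mul_mult`). Suppose every cell of a set `Z` is forced to be empty.
Complementing outside `Z` then turns coverings of one vertex set into coverings of another: a vertex
with one of its cells in `Z` changes between present and removed, one with both cells in `Z` is
removed on both sides, and one with no cell in `Z` is present on both sides. The total factor is the
same for all coverings (`card_isFilling_compl`).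

The windows `O_{k,q+1}` and `O_{k+1,q}` with a common centre, where `l = q + 1`, both come from one
block of `(k+1) × (q+1)` cells. In one direction a window consists of the vertices touching the
block, in the other of the vertices with both cells in the block, and the two windows interchange
these directions. With `Z` the union of all blocks, complementation thus exchanges the two families
of holes.

It remains to see that blocks are disjoint, and that blocks of one colour neither touch each other
nor close up around the torus. Disjoint windows give part of this. The rest comes from the existence
of a perfect matching: a vertex between two cells of blocks of the same colour either belongs to a
window already or has lost all its neighbours, so it must lie in a hole (`IsWindowConfig.eq_black`,
`IsWindowConfig.eq_white`). Counting cells and horizontal vertices gives the exponent. -/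

/-! ### Matchings of a single 4-cycle. -/

/-- A set of edges of a `4`-cycle: `f a b` says that the edge joining the horizontal vertex `a`
to the vertical vertex `b` is used. -/
abbrev CellState : Type := Bool → Bool → Bool

/-- A set of vertices of a `4`-cycle: the horizontal and the vertical vertices in the set. -/
abbrev CellPattern : Type := (Bool → Bool) × (Bool → Bool)

/-- The vertices covered by a set of edges of a `4`-cycle. -/
def CellState.cover (f : CellState) : CellPattern :=
  (fun a => f a false || f a true, fun b => f false b || f true b)

/-- The set of edges of a `4`-cycle is a matching. -/
def CellState.IsMatching (f : CellState) : Prop :=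
  (∀ a, (f a false && f a true) = false) ∧ ∀ b, (f false b && f true b) = false

instance : DecidablePred CellState.IsMatching := fun f => by
  unfold CellState.IsMatching; infer_instance

/-- The number of matchings of a `4`-cycle that cover exactly the given vertices. -/
def CellPattern.mult (p : CellPattern) : ℕ :=
  (Finset.univ.filter fun f : CellState => f.IsMatching ∧ f.cover = p).card

/-- The complementary set of vertices of a `4`-cycle. -/
def CellPattern.compl (p : CellPattern) : CellPattern := (fun a => !p.1 a, fun b => !p.2 b)

/-- The empty set of vertices of a `4`-cycle. -/
def CellPattern.empty : CellPattern := (fun _ => false, fun _ => false)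

/-- The number of horizontal vertices in a set of vertices of a `4`-cycle. -/
def CellPattern.size (p : CellPattern) : ℕ := (p.1 true).toNat + (p.1 false).toNat

lemma CellPattern.compl_compl (p : CellPattern) : p.compl.compl = p := by
  simp [CellPattern.compl]

-- The local form of complementation. The empty pattern has multiplicity 1, the full one 2, a
-- horizontal-vertical pair 1, and all others 0. Complementation swaps the first two and permutes
-- the remaining admissible patterns.
set_option maxRecDepth 100000 in
set_option maxHeartbeats 4000000 in
lemma CellPattern.two_mul_mult : ∀ p : CellPattern, 2 * p.mult = 2 ^ p.size * p.compl.mult := by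
  decide +kernel

/-- Each edge of the cycle joins a horizontal to a vertical vertex, so a matching that avoids one
kind has no edges. -/
lemma CellPattern.eq_empty_of_mult_ne_zero : ∀ p : CellPattern, p.mult ≠ 0 →
    ((p.1 true = false ∧ p.1 false = false) ∨ (p.2 true = false ∧ p.2 false = false)) →
    p = CellPattern.empty := by
  decide +kernel

/-! ### Complementation for systems of 4-cycles. -/

section Covering

variable {C : Type*} (σ τ : Equiv.Perm C)

/-- A choice of vertices in each of the cells covers each vertex in `hA` and `hB` once and the
others not at all. The vertex `hA c` is shared by `c` and `σ c`, `hB c` by `c` and `τ c`. -/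
def IsCovering (hA hB : C → Bool) (P : C → CellPattern) : Prop :=
  (∀ c, ((P c).1 true).toNat + ((P (σ c)).1 false).toNat = (hA c).toNat) ∧
  (∀ c, ((P c).2 true).toNat + ((P (τ c)).2 false).toNat = (hB c).toNat)

/-- A matching in each cell, such that the union is a perfect matching of the vertices in `hA`
and `hB`. -/
def IsFilling (hA hB : C → Bool) (F : C → CellState) : Prop :=
  (∀ c, (F c).IsMatching) ∧ IsCovering σ τ hA hB fun c => (F c).cover

variable {σ τ}

open Classical in
lemma card_isFilling [Fintype C] (hA hB : C → Bool) :
    Nat.card {F : C → CellState // IsFilling σ τ hA hB F} =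
      ∑ P : C → CellPattern with IsCovering σ τ hA hB P, ∏ c, (P c).mult := by
  rw [Nat.card_eq_fintype_card, Fintype.card_subtype]
  rw [Finset.card_eq_sum_card_fiberwise (f := fun F : C → CellState => fun c => (F c).cover)
    (t := Finset.univ.filter fun P => IsCovering σ τ hA hB P)]
  · refine Finset.sum_congr rfl fun P hP => ?_
    rw [Finset.mem_filter] at hP
    simp only [CellPattern.mult]
    rw [← Fintype.card_piFinset]
    congr 1
    ext F
    simp only [Finset.mem_filter, Finset.mem_univ, true_and, Fintype.mem_piFinset]
    constructor
    · rintro ⟨⟨h1, -⟩, h2⟩ c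
      exact ⟨h1 c, congrFun h2 c⟩
    · intro h
      have h2 : (fun c => (F c).cover) = P := funext fun c => (h c).2
      exact ⟨⟨fun c => (h c).1, h2 ▸ hP.2⟩, h2⟩
  · intro F hF
    rw [Finset.mem_coe, Finset.mem_filter] at hF ⊢
    exact ⟨Finset.mem_univ _, hF.2.2⟩

lemma IsCovering.sum_size [Fintype C] {hA hB : C → Bool} {P : C → CellPattern}
    (h : IsCovering σ τ hA hB P) : ∑ c, (P c).size = ∑ c, (hA c).toNat := by
  simp only [CellPattern.size, Finset.sum_add_distrib]
  rw [← Equiv.sum_comp σ fun c => ((P c).1 false).toNat, ← Finset.sum_add_distrib]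
  exact Finset.sum_congr rfl fun c _ => h.1 c

open Classical in
/-- The complement of a pattern in the cells outside `Z`. -/
noncomputable def complOff (Z : Set C) (P : C → CellPattern) (c : C) : CellPattern :=
  if c ∈ Z then CellPattern.empty else (P c).compl

lemma complOff_complOff {Z : Set C} {P : C → CellPattern}
    (hP : ∀ c ∈ Z, P c = CellPattern.empty) : complOff Z (complOff Z P) = P := by
  funext c
  by_cases hc : c ∈ Z
  · simp [complOff, hc, hP]
  · simp [complOff, hc, CellPattern.compl_compl]

open Classical in
/-- The vertex sets `(hA, hB)` and `(hA', hB')` are complementary off the cells in `Z`. -/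
def IsComplementary (σ τ : Equiv.Perm C) (Z : Set C) (hA hB hA' hB' : C → Bool) : Prop :=
  (∀ c, (hA c).toNat + (hA' c).toNat + (if c ∈ Z then 1 else 0) + (if σ c ∈ Z then 1 else 0) = 2) ∧
  (∀ c, (hB c).toNat + (hB' c).toNat + (if c ∈ Z then 1 else 0) + (if τ c ∈ Z then 1 else 0) = 2)

lemma IsComplementary.symm {Z : Set C} {hA hB hA' hB' : C → Bool}
    (h : IsComplementary σ τ Z hA hB hA' hB') : IsComplementary σ τ Z hA' hB' hA hB :=
  ⟨fun c => by rw [add_comm (hA' c).toNat]; exact h.1 c,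
    fun c => by rw [add_comm (hB' c).toNat]; exact h.2 c⟩

open Classical in
lemma IsCovering.complOff {Z : Set C} {hA hB hA' hB' : C → Bool}
    (hc : IsComplementary σ τ Z hA hB hA' hB') {P : C → CellPattern}
    (h : IsCovering σ τ hA hB P) (hP : ∀ c ∈ Z, P c = CellPattern.empty) :
    IsCovering σ τ hA' hB' (complOff Z P) := by
  have key : ∀ (x y a b : Bool) (p q : Prop) [Decidable p] [Decidable q],
      x.toNat + y.toNat = a.toNat →
      a.toNat + b.toNat + (if p then 1 else 0) + (if q then 1 else 0) = 2 →
      (p → x = false) → (q → y = false) →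
      (if p then false else !x).toNat + (if q then false else !y).toNat = b.toNat := by
    intro x y a b p q _ _
    by_cases p <;> by_cases q <;> revert x y a b <;> simp_all
  have e1 : ∀ c a, (AztecWindows.complOff Z P c).1 a = if c ∈ Z then false else !(P c).1 a := by
    intro c a
    unfold AztecWindows.complOff
    split_ifs <;> rfl
  have e2 : ∀ c a, (AztecWindows.complOff Z P c).2 a = if c ∈ Z then false else !(P c).2 a := by
    intro c a
    unfold AztecWindows.complOff
    split_ifs <;> rfl
  refine ⟨fun c => ?_, fun c => ?_⟩
  · rw [e1, e1]
    exact key _ _ _ _ _ _ (h.1 c) (hc.1 c) (fun hz => by rw [hP c hz]; rfl)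
      (fun hz => by rw [hP _ hz]; rfl)
  · rw [e2, e2]
    exact key _ _ _ _ _ _ (h.2 c) (hc.2 c) (fun hz => by rw [hP c hz]; rfl)
      (fun hz => by rw [hP _ hz]; rfl)

/-- All vertices of one of the two kinds are missing around every cell of `Z`. -/
def Avoids (σ τ : Equiv.Perm C) (Z : Set C) (hA hB : C → Bool) : Prop :=
  ∀ c ∈ Z, (hA c = false ∧ hA (σ.symm c) = false) ∨ (hB c = false ∧ hB (τ.symm c) = false)

/-- This is what makes `Z` consist of forced empty cells, so that only the cells outside it need
complementing. -/
lemma IsCovering.eq_empty {Z : Set C} {hA hB : C → Bool} (hz : Avoids σ τ Z hA hB)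
    {P : C → CellPattern} (h : IsCovering σ τ hA hB P) (h0 : ∀ c, (P c).mult ≠ 0) :
    ∀ c ∈ Z, P c = CellPattern.empty := by
  have key : ∀ x y : Bool, x.toNat + y.toNat = false.toNat → x = false ∧ y = false := by decide
  intro c hc
  refine CellPattern.eq_empty_of_mult_ne_zero _ (h0 c) ?_
  rcases hz c hc with ⟨h1, h2⟩ | ⟨h1, h2⟩
  · left
    have a1 := h.1 c
    have a2 := h.1 (σ.symm c)
    rw [h1] at a1
    rw [h2, Equiv.apply_symm_apply] at a2
    exact ⟨(key _ _ a1).1, (key _ _ a2).2⟩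
  · right
    have a1 := h.2 c
    have a2 := h.2 (τ.symm c)
    rw [h1] at a1
    rw [h2, Equiv.apply_symm_apply] at a2
    exact ⟨(key _ _ a1).1, (key _ _ a2).2⟩

open Classical in
lemma card_isFilling_eq_sum [Fintype C] {Z : Set C} {hA hB : C → Bool} (hz : Avoids σ τ Z hA hB) :
    Nat.card {F : C → CellState // IsFilling σ τ hA hB F} =
      ∑ P : C → CellPattern with IsCovering σ τ hA hB P ∧ ∀ c ∈ Z, P c = CellPattern.empty,
        ∏ c, (P c).mult := by
  rw [card_isFilling]
  symm
  refine Finset.sum_subset (fun P hP => ?_) fun P hP hP' => ?_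
  · simp only [Finset.mem_filter, Finset.mem_univ, true_and] at hP ⊢
    exact hP.1
  · simp only [Finset.mem_filter, Finset.mem_univ, true_and] at hP hP'
    by_contra h0
    exact hP' ⟨hP, hP.eq_empty hz fun c hc => h0 (Finset.prod_eq_zero (Finset.mem_univ c) hc)⟩

open Classical in
/-- The complementation theorem for graphs made of `4`-cycles. -/
theorem card_isFilling_compl [Fintype C] {Z : Set C} {hA hB hA' hB' : C → Bool}
    (hc : IsComplementary σ τ Z hA hB hA' hB') (hz : Avoids σ τ Z hA hB)
    (hz' : Avoids σ τ Z hA' hB') :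
    2 ^ Nat.card {c // c ∉ Z} * Nat.card {F : C → CellState // IsFilling σ τ hA hB F} =
      2 ^ Nat.card {c // hA c = true} *
        Nat.card {F : C → CellState // IsFilling σ τ hA' hB' F} := by
  rw [card_isFilling_eq_sum hz, card_isFilling_eq_sum hz', Finset.mul_sum, Finset.mul_sum]
  refine Finset.sum_nbij' (complOff Z) (complOff Z) ?_ ?_ ?_ ?_ ?_
  · intro P hP
    simp only [Finset.mem_filter, Finset.mem_univ, true_and] at hP ⊢
    exact ⟨hP.1.complOff hc hP.2, fun c hcz => by simp [complOff, hcz]⟩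
  · intro P hP
    simp only [Finset.mem_filter, Finset.mem_univ, true_and] at hP ⊢
    exact ⟨hP.1.complOff hc.symm hP.2, fun c hcz => by simp [complOff, hcz]⟩
  · intro P hP
    simp only [Finset.mem_filter, Finset.mem_univ, true_and] at hP
    exact complOff_complOff hP.2
  · intro P hP
    simp only [Finset.mem_filter, Finset.mem_univ, true_and] at hP
    exact complOff_complOff hP.2
  · intro P hP
    simp only [Finset.mem_filter, Finset.mem_univ, true_and] at hP
    have e1 : 2 ^ Nat.card {c // c ∉ Z} = ∏ c, (if c ∈ Z then 1 else 2) := by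
      rw [Finset.prod_ite, Finset.prod_const_one, one_mul, Finset.prod_const,
        Nat.card_eq_fintype_card, Fintype.card_subtype]
    -- Each horizontal vertex present is covered by exactly one cell, so the sizes have the same sum
    -- for every covering and the cell factors multiply to a constant.
    have e2 : 2 ^ Nat.card {c // hA c = true} = ∏ c, 2 ^ (P c).size := by
      rw [Finset.prod_pow_eq_pow_sum, hP.1.sum_size, Nat.card_eq_fintype_card,
        Fintype.card_subtype, Finset.card_filter]
      congr 1
      refine Finset.sum_congr rfl fun c _ => ?_
      cases hA c <;> rfl
    rw [e1, e2, ← Finset.prod_mul_distrib, ← Finset.prod_mul_distrib]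
    refine Finset.prod_congr rfl fun c _ => ?_
    unfold complOff
    split_ifs with hcz
    · rw [hP.2 c hcz]
      simp [CellPattern.size, CellPattern.empty]
    · exact CellPattern.two_mul_mult _

end Covering

/-! ### Perfect matchings of a graph whose edges are partitioned into 4-cycles. -/

section CellGraph

variable {V C : Type*}

/-- The horizontal vertices of the cell `c`, where `A c` is shared by `c` and `σ c`. -/
def cellVertex (σ : Equiv.Perm C) (A : C → V) (c : C) (a : Bool) : V :=
  A (bif a then c else σ.symm c)

/-- The edges of `G` are partitioned into `4`-cycles, indexed by `C`, each vertex being on two of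
them, as a horizontal vertex of both (`A c`, on `c` and `σ c`) or as a vertical vertex of both
(`B c`, on `c` and `τ c`). -/
structure IsCellGraph (G : SimpleGraph V) (σ τ : Equiv.Perm C) (A B : C → V) : Prop where
  injA : Function.Injective A
  injB : Function.Injective B
  ne : ∀ c d, A c ≠ B d
  surj : ∀ v, (∃ c, v = A c) ∨ ∃ c, v = B c
  adj_iff : ∀ u v, G.Adj u v ↔ ∃ c a b, (u = cellVertex σ A c a ∧ v = cellVertex τ B c b) ∨
    (u = cellVertex τ B c b ∧ v = cellVertex σ A c a)
  edge_inj : ∀ c c' a a' b b', cellVertex σ A c a = cellVertex σ A c' a' →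
    cellVertex τ B c b = cellVertex τ B c' b' → c = c' ∧ a = a' ∧ b = b'

/-- Here `g` lists the four edges at a vertex, two in each of its cells. Exactly one being used
means at most one per cell, and exactly one of the two cells covering the vertex. -/
lemma exists_unique_iff_toNat : ∀ (g : Bool → Bool → Bool) (h : Bool),
    ((h = true → ∃! p : Bool × Bool, g p.1 p.2 = true) ∧ (h = false → ∀ x y, g x y = false)) ↔
    ((g true false && g true true) = false ∧ (g false false && g false true) = false ∧
      (g true false || g true true).toNat + (g false false || g false true).toNat = h.toNat) := by
  simp only [ExistsUnique]
  decide +kernel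

/-- Each vertex `A c` with `h c` is on exactly one chosen edge, the others on none. -/
def CoversOnce (σ : Equiv.Perm C) (h : C → Bool) (F : C → CellState) : Prop :=
  ∀ c, (h c = true → ∃! p : Bool × Bool, F (bif p.1 then c else σ c) p.1 p.2 = true) ∧
    (h c = false → ∀ x y, F (bif x then c else σ c) x y = false)

/-- Regroups the conditions by vertices instead of cells: each of the four vertices of a cell is the
shared vertex of that cell or of its predecessor. -/
lemma isFilling_iff {σ τ : Equiv.Perm C} {hA hB : C → Bool} {F : C → CellState} :
    IsFilling σ τ hA hB F ↔
      CoversOnce σ hA F ∧ CoversOnce τ hB fun c b a => F c a b := by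
  have e1 := fun c => exists_unique_iff_toNat (fun x y => F (bif x then c else σ c) x y) (hA c)
  have e2 := fun c => exists_unique_iff_toNat (fun x y => F (bif x then c else τ c) y x) (hB c)
  simp only [cond_true, cond_false] at e1 e2
  simp only [CoversOnce, e1, e2, IsFilling, IsCovering, CellState.IsMatching, CellState.cover]
  constructor
  · rintro ⟨h1, h2, h3⟩
    exact ⟨fun c => ⟨(h1 c).1 true, (h1 _).1 false, h2 c⟩,
      fun c => ⟨(h1 c).2 true, (h1 _).2 false, h3 c⟩⟩
  · rintro ⟨h1, h2⟩
    refine ⟨fun c => ⟨fun a => ?_, fun b => ?_⟩, fun c => (h1 c).2.2, fun c => (h2 c).2.2⟩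
    · cases a
      · simpa using (h1 (σ.symm c)).2.1
      · exact (h1 c).1
    · cases b
      · simpa using (h2 (τ.symm c)).2.1
      · exact (h2 c).1

/-- The reflection symmetry that lets every statement about horizontal vertices be reused for
vertical ones. -/
lemma IsCellGraph.swap {G : SimpleGraph V} {σ τ : Equiv.Perm C} {A B : C → V}
    (h : IsCellGraph G σ τ A B) : IsCellGraph G τ σ B A where
  injA := h.injB
  injB := h.injA
  ne c d := (h.ne d c).symm
  surj v := (h.surj v).symm
  adj_iff u v := by
    rw [h.adj_iff]
    exact ⟨fun ⟨c, a, b, hc⟩ => ⟨c, b, a, hc.symm⟩, fun ⟨c, a, b, hc⟩ => ⟨c, b, a, hc.symm⟩⟩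
  edge_inj c c' a a' b b' h1 h2 := by
    obtain ⟨h3, h4, h5⟩ := h.edge_inj c c' b b' a a' h2 h1
    exact ⟨h3, h5, h4⟩

variable {G : SimpleGraph V} {σ τ : Equiv.Perm C} {A B : C → V} {S : Set V}

open Classical in
/-- The edges of a perfect matching, cell by cell. -/
noncomputable def cellEdges (σ τ : Equiv.Perm C) (A B : C → V) (M : (G.induce S).Subgraph)
    (c : C) (a b : Bool) : Bool :=
  decide (∃ hu hv, M.Adj ⟨cellVertex σ A c a, hu⟩ ⟨cellVertex τ B c b, hv⟩)

lemma cellEdges_eq_true {M : (G.induce S).Subgraph} {c : C} {a b : Bool} :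
    cellEdges σ τ A B M c a b = true ↔
      ∃ hu hv, M.Adj ⟨cellVertex σ A c a, hu⟩ ⟨cellVertex τ B c b, hv⟩ := by
  simp [cellEdges]

lemma cellEdges_swap (M : (G.induce S).Subgraph) :
    (fun c b a => cellEdges σ τ A B M c a b) = cellEdges τ σ B A M := by
  funext c b a
  rw [Bool.eq_iff_iff, cellEdges_eq_true, cellEdges_eq_true]
  exact ⟨fun ⟨h1, h2, h3⟩ => ⟨h2, h1, h3.symm⟩, fun ⟨h1, h2, h3⟩ => ⟨h2, h1, h3.symm⟩⟩

open Classical in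
/-- The indices of the vertices in a set. -/
noncomputable def inSet (A : C → V) (S : Set V) (c : C) : Bool := decide (A c ∈ S)

@[simp] lemma inSet_eq_true {c : C} : inSet A S c = true ↔ A c ∈ S := by simp [inSet]

@[simp] lemma inSet_eq_false {c : C} : inSet A S c = false ↔ A c ∉ S := by simp [inSet]

lemma cellVertex_cond (c : C) (x : Bool) : cellVertex σ A (bif x then c else σ c) x = A c := by
  cases x <;> simp [cellVertex]

lemma IsCellGraph.eq_cond (h : IsCellGraph G σ τ A B) {c d : C} {x : Bool}
    (he : A c = cellVertex σ A d x) : d = bif x then c else σ c := by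
  have := h.injA he
  cases x <;> simp_all

lemma IsCellGraph.coversOnce (h : IsCellGraph G σ τ A B) {M : (G.induce S).Subgraph}
    (hM : M.IsPerfectMatching) :
    CoversOnce σ (inSet A S) (cellEdges σ τ A B M) := by
  rw [SimpleGraph.Subgraph.isPerfectMatching_iff] at hM
  intro c
  constructor
  · intro hc
    have hc : A c ∈ S := by simpa using hc
    obtain ⟨w, hw, hu⟩ := hM ⟨A c, hc⟩
    have hadj : G.Adj (A c) w.1 := M.adj_sub hw
    rw [h.adj_iff] at hadj
    obtain ⟨d, a, b, ⟨h1, h2⟩ | ⟨h1, -⟩⟩ := hadj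
    · have hd := h.eq_cond h1
      refine ⟨(a, b), ?_, ?_⟩
      · simp only [cellEdges_eq_true]
        rw [← hd]
        refine ⟨h1 ▸ hc, h2 ▸ w.2, ?_⟩
        convert hw using 1
        · exact Subtype.ext h1.symm
        · exact Subtype.ext h2.symm
      · rintro ⟨x, y⟩ hxy
        simp only [cellEdges_eq_true] at hxy
        obtain ⟨h3, h4, h5⟩ := hxy
        have h6 : cellVertex τ B (bif x then c else σ c) y = w.1 := by
          refine congrArg Subtype.val (hu ⟨_, h4⟩ ?_)
          convert h5 using 1
          exact Subtype.ext (cellVertex_cond c x).symm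
        -- An edge lies in only one cell and in one position there, so a unique partner gives a
        -- unique position.
        obtain ⟨-, h7, h8⟩ := h.edge_inj _ _ x a y b ((cellVertex_cond c x).trans h1) (h6.trans h2)
        rw [h7, h8]
    · exact absurd h1 (h.ne _ _)
  · intro hc x y
    have hc : A c ∉ S := by simpa using hc
    rw [Bool.eq_false_iff, ne_eq, cellEdges_eq_true]
    rintro ⟨h1, -⟩
    rw [cellVertex_cond] at h1
    exact hc h1

/-- The subgraph with the chosen edges. -/
def subgraphOfCells (h : IsCellGraph G σ τ A B) (S : Set V) (F : C → CellState) :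
    (G.induce S).Subgraph where
  verts := Set.univ
  Adj u v := ∃ c a b, F c a b = true ∧
    ((u.1 = cellVertex σ A c a ∧ v.1 = cellVertex τ B c b) ∨
      (u.1 = cellVertex τ B c b ∧ v.1 = cellVertex σ A c a))
  adj_sub := by
    rintro u v ⟨c, a, b, -, hc⟩
    exact (h.adj_iff u.1 v.1).2 ⟨c, a, b, hc⟩
  edge_vert _ := Set.mem_univ _
  symm := ⟨by
    rintro u v ⟨c, a, b, hF, hc⟩
    exact ⟨c, a, b, hF, hc.symm.imp And.symm And.symm⟩⟩

lemma CoversOnce.mem {F : C → CellState} (hF : CoversOnce σ (inSet A S) F)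
    {c : C} {a b : Bool} (h : F c a b = true) : cellVertex σ A c a ∈ S := by
  by_contra hc
  have := (hF (bif a then c else σ.symm c)).2 (by simpa [cellVertex] using hc) a b
  cases a <;> simp_all

lemma IsCellGraph.existsUnique_adj (h : IsCellGraph G σ τ A B) {F : C → CellState}
    (hA : CoversOnce σ (inSet A S) F)
    (hB : CoversOnce τ (inSet B S) fun c b a => F c a b) (c : C) (hc : A c ∈ S) :
    ∃! w, (subgraphOfCells h S F).Adj ⟨A c, hc⟩ w := by
  obtain ⟨⟨x, y⟩, hxy, hu⟩ := (hA c).1 (by simpa using hc)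
  refine ⟨⟨_, hB.mem hxy⟩, ⟨_, x, y, hxy, Or.inl ⟨(cellVertex_cond c x).symm, rfl⟩⟩, ?_⟩
  rintro ⟨w, hw⟩ ⟨d, a, b, h1, ⟨h2, h3⟩ | ⟨h2, -⟩⟩
  · have hd := h.eq_cond h2
    simp only at h3
    have := hu (a, b) (by rw [hd] at h1; exact h1)
    simp only [Prod.mk.injEq] at this
    refine Subtype.ext ?_
    simp only [h3, hd, this]
  · exact absurd h2 (h.ne _ _)

lemma subgraphOfCells_swap (h : IsCellGraph G σ τ A B) (F : C → CellState) :
    subgraphOfCells h.swap S (fun c b a => F c a b) = subgraphOfCells h S F := by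
  refine SimpleGraph.Subgraph.ext rfl ?_
  funext u v
  exact propext ⟨fun ⟨c, a, b, h1, h2⟩ => ⟨c, b, a, h1, h2.symm⟩,
    fun ⟨c, a, b, h1, h2⟩ => ⟨c, b, a, h1, h2.symm⟩⟩

/-- Perfect matchings of an induced subgraph, cell by cell. -/
theorem IsCellGraph.numPerfectMatchings_eq (h : IsCellGraph G σ τ A B) (S : Set V) :
    numPerfectMatchings (G.induce S) = Nat.card {F : C → CellState //
      IsFilling σ τ (inSet A S) (inSet B S) F} := by
  refine Nat.card_congr
    { toFun := fun M => ⟨cellEdges σ τ A B M.1, isFilling_iff.2 ⟨h.coversOnce M.2, ?_⟩⟩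
      invFun := fun F => ⟨subgraphOfCells h S F.1, ?_⟩
      left_inv := ?_
      right_inv := ?_ }
  · rw [cellEdges_swap]
    exact h.swap.coversOnce M.2
  · obtain ⟨hA, hB⟩ := isFilling_iff.1 F.2
    rw [SimpleGraph.Subgraph.isPerfectMatching_iff]
    rintro ⟨v, hv⟩
    obtain ⟨c, rfl⟩ | ⟨c, rfl⟩ := h.surj v
    · exact h.existsUnique_adj hA hB c hv
    · rw [← subgraphOfCells_swap]
      exact h.swap.existsUnique_adj hB hA c hv
  · rintro ⟨M, hM⟩
    refine Subtype.ext (SimpleGraph.Subgraph.ext ?_ ?_)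
    · exact (Set.eq_univ_of_forall hM.2).symm
    · funext u v
      refine propext ⟨?_, fun huv => ?_⟩
      · rintro ⟨c, a, b, hF, hc⟩
        rw [cellEdges_eq_true] at hF
        obtain ⟨h1, h2, h3⟩ := hF
        rcases hc with ⟨h4, h5⟩ | ⟨h4, h5⟩
        · obtain rfl : u = ⟨_, h1⟩ := Subtype.ext h4
          obtain rfl : v = ⟨_, h2⟩ := Subtype.ext h5
          exact h3
        · obtain rfl : u = ⟨_, h2⟩ := Subtype.ext h4
          obtain rfl : v = ⟨_, h1⟩ := Subtype.ext h5
          exact h3.symm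
      · have hadj : G.Adj u.1 v.1 := M.adj_sub huv
        rw [h.adj_iff] at hadj
        obtain ⟨c, a, b, hc⟩ := hadj
        refine ⟨c, a, b, ?_, hc⟩
        rw [cellEdges_eq_true]
        rcases hc with ⟨h4, h5⟩ | ⟨h4, h5⟩
        · refine ⟨h4 ▸ u.2, h5 ▸ v.2, ?_⟩
          convert huv using 1
          · exact Subtype.ext h4.symm
          · exact Subtype.ext h5.symm
        · refine ⟨h5 ▸ v.2, h4 ▸ u.2, ?_⟩
          convert huv.symm using 1
          · exact Subtype.ext h5.symm
          · exact Subtype.ext h4.symm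
  · rintro ⟨F, hF⟩
    obtain ⟨hA, hB⟩ := isFilling_iff.1 hF
    refine Subtype.ext ?_
    funext c a b
    rw [Bool.eq_iff_iff, cellEdges_eq_true]
    constructor
    · rintro ⟨h1, h2, c', a', b', h3, ⟨h4, h5⟩ | ⟨h4, -⟩⟩
      · obtain ⟨rfl, rfl, rfl⟩ := h.edge_inj _ _ _ _ _ _ h4 h5
        exact h3
      · exact absurd h4 (h.ne _ _)
    · intro hf
      exact ⟨hA.mem hf, hB.mem hf, c, a, b, hf, Or.inl ⟨rfl, rfl⟩⟩

end CellGraph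

/-! ### Coordinates, adjacency and colourings on the torus. -/

/-- The parity of a row or column of the torus. -/
def parity (m : ℕ) : ZMod (2 * m) →+* ZMod 2 := ZMod.castHom (Dvd.intro m rfl) (ZMod 2)

lemma zmod_two_two : (2 : ZMod 2) = 0 := by decide

lemma zmod_two_neg_one : (-1 : ZMod 2) = 1 := by decide

lemma exists_natCast_eq {m : ℕ} (hm : 0 < m) (x : ZMod (2 * m)) :
    ∃ i : ℕ, i < 2 * m ∧ (i : ZMod (2 * m)) = x := by
  have : NeZero (2 * m) := ⟨by omega⟩
  exact ⟨x.val, x.val_lt, by simp⟩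

lemma natCast_zmod_two_eq_one {i : ℕ} : (i : ZMod 2) = 1 ↔ Odd i :=
  ZMod.natCast_eq_one_iff_odd

lemma mem_range_wrap {m n : ℕ} (hm : 0 < m) (hn : 0 < n) (x : TorusSquare m n) :
    x ∈ Set.range (wrap m n) ↔ parity m x.1 + parity n x.2 = 1 := by
  constructor
  · rintro ⟨p, rfl⟩
    simp only [wrap, map_natCast]
    rw [← Nat.cast_add, natCast_zmod_two_eq_one]
    exact p.2.2.2
  · intro h
    obtain ⟨x, y⟩ := x
    obtain ⟨i, hi, rfl⟩ := exists_natCast_eq hm x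
    obtain ⟨j, hj, rfl⟩ := exists_natCast_eq hn y
    simp only [map_natCast] at h
    rw [← Nat.cast_add, natCast_zmod_two_eq_one] at h
    exact ⟨⟨(i, j), hi.le, hj.le, h⟩, rfl⟩

/-- The tool for excluding wrap-around: congruent integers less than one period apart are equal. -/
lemma intCast_eq_of_lt {N : ℕ} {a b : ℤ} (h : (a : ZMod N) = b) (h1 : a - b < N)
    (h2 : b - a < N) : a = b := by
  rw [ZMod.intCast_eq_intCast_iff_dvd_sub] at h
  obtain ⟨c, hc⟩ := h
  rcases lt_trichotomy c 0 with h0 | h0 | h0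
  · nlinarith
  · subst h0; linarith
  · nlinarith

/-- Two rows (or columns) of the torus are neighbours. -/
def IsNext {N : ℕ} (x y : ZMod N) : Prop := y = x + 1 ∨ y = x - 1

lemma IsNext.symm {N : ℕ} {x y : ZMod N} (h : IsNext x y) : IsNext y x := by
  rcases h with rfl | rfl
  · right; ring
  · left; ring

lemma IsNext.lift {m : ℕ} (hm : 0 < m) {x y : ZMod (2 * m)} (h : IsNext x y) :
    ∃ i j : ℕ, i ≤ 2 * m ∧ j ≤ 2 * m ∧ (i : ZMod (2 * m)) = x ∧ (j : ZMod (2 * m)) = y ∧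
      |(i : ℤ) - j| = 1 := by
  rcases h with rfl | h
  · obtain ⟨i, hi, rfl⟩ := exists_natCast_eq hm x
    exact ⟨i, i + 1, hi.le, hi, rfl, by push_cast; rfl, by push_cast; simp⟩
  · obtain ⟨i, hi, rfl⟩ := exists_natCast_eq hm y
    refine ⟨i + 1, i, hi, hi.le, ?_, rfl, by push_cast; simp⟩
    push_cast
    rw [h]
    ring

lemma isNext_of_abs {N : ℕ} {i j : ℕ} (h : |(i : ℤ) - j| = 1) : IsNext (i : ZMod N) j := by
  rcases (abs_eq zero_le_one).1 h with h | h
  · obtain rfl : i = j + 1 := by omega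
    right; push_cast; ring
  · obtain rfl : j = i + 1 := by omega
    left; push_cast; ring

lemma IsNext.parity_eq {m : ℕ} {x y : ZMod (2 * m)} (h : IsNext x y) :
    parity m y = parity m x + 1 := by
  rcases h with rfl | rfl
  · simp
  · rw [map_sub, map_one, sub_eq_add_neg, zmod_two_neg_one]

lemma toroidal_adj {m n : ℕ} (hm : 0 < m) (hn : 0 < n) (u v : ToroidalVertex m n) :
    (toroidalAztecRectangle m n).Adj u v ↔ IsNext u.1.1 v.1.1 ∧ IsNext u.1.2 v.1.2 := by
  unfold toroidalAztecRectangle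
  rw [SimpleGraph.map_adj']
  constructor
  · rintro ⟨-, p, q, hpq, rfl, rfl⟩
    exact ⟨isNext_of_abs hpq.1, isNext_of_abs hpq.2⟩
  · rintro ⟨h1, h2⟩
    have hne : u ≠ v := by
      rintro rfl
      have := h1.parity_eq
      simp at this
    obtain ⟨i, i', hi, hi', e1, e2, e3⟩ := h1.lift hm
    obtain ⟨j, j', hj, hj', e4, e5, e6⟩ := h2.lift hn
    have hu := (mem_range_wrap hm hn u.1).1 u.2
    have hv := (mem_range_wrap hm hn v.1).1 v.2
    rw [← e1, ← e4, map_natCast, map_natCast, ← Nat.cast_add, natCast_zmod_two_eq_one] at hu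
    rw [← e2, ← e5, map_natCast, map_natCast, ← Nat.cast_add, natCast_zmod_two_eq_one] at hv
    exact ⟨hne, ⟨(i, j), hi, hj, hu⟩, ⟨(i', j'), hi', hj', hv⟩, ⟨e3, e6⟩,
      Subtype.ext (Prod.ext e1 e4), Subtype.ext (Prod.ext e2 e5)⟩

open Classical in
/-- Every colouring is the colouring by the parity of the rows, up to the names of the colours. -/
lemma exists_color_parity {m n : ℕ} (hm : 0 < m) (hn : 0 < n)
    (col : (toroidalAztecRectangle m n).Coloring Bool) :
    ∃ ε : ZMod 2, ∀ v : ToroidalVertex m n, col v = true ↔ parity m v.1.1 = ε := by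
  -- Extending the colouring by a junk value to all squares allows translation without carrying
  -- membership proofs.
  set χ : TorusSquare m n → Bool := fun x =>
    if h : x ∈ Set.range (wrap m n) then col ⟨x, h⟩ else false with hχ
  have hval : ∀ v : ToroidalVertex m n, χ v.1 = col v := fun v => by
    simp only [hχ, dif_pos v.2]
  have hmem := mem_range_wrap hm hn
  have hstep : ∀ x y : TorusSquare m n, x ∈ Set.range (wrap m n) → IsNext x.1 y.1 →
      IsNext x.2 y.2 → y ∈ Set.range (wrap m n) ∧ χ y = !χ x := by
    intro x y hx h1 h2
    have hy : y ∈ Set.range (wrap m n) := by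
      rw [hmem] at hx ⊢
      rw [h1.parity_eq, h2.parity_eq]
      linear_combination hx + zmod_two_two
    refine ⟨hy, ?_⟩
    have := col.valid ((toroidal_adj hm hn ⟨x, hx⟩ ⟨y, hy⟩).2 ⟨h1, h2⟩)
    rw [← hval, ← hval] at this
    revert this
    cases χ x <;> cases χ y <;> simp
  -- Moving two rows down is the sum of two diagonal steps, each of which flips the colour.
  -- Translations by even vectors therefore preserve it, and `(0, 1)` and `(1, 0)` represent the two
  -- colour classes.
  have hrow : ∀ (a : ℕ) (x : TorusSquare m n), x ∈ Set.range (wrap m n) →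
      (x + ((2 * a, 0) : TorusSquare m n)) ∈ Set.range (wrap m n) ∧ χ (x + ((2 * a, 0) : TorusSquare m n)) = χ x := by
    intro a
    induction a with
    | zero => intro x hx; simpa only [Nat.cast_zero, mul_zero, Prod.mk_zero_zero, add_zero, and_true] using hx
    | succ a ih =>
      intro x hx
      obtain ⟨h1, h2⟩ := ih x hx
      obtain ⟨h3, h4⟩ := hstep _ (x + ((2 * a + 1, 1) : TorusSquare m n)) h1 (Or.inl (by simp; ring))
        (Or.inl (by simp))
      obtain ⟨h5, h6⟩ := hstep _ (x + ((2 * (a + 1 : ℕ), 0) : TorusSquare m n)) h3 (Or.inl (by simp; ring))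
        (Or.inr (by simp))
      exact ⟨h5, by rw [h6, h4, h2, Bool.not_not]⟩
  have hcol : ∀ (a : ℕ) (x : TorusSquare m n), x ∈ Set.range (wrap m n) →
      (x + ((0, 2 * a) : TorusSquare m n)) ∈ Set.range (wrap m n) ∧ χ (x + ((0, 2 * a) : TorusSquare m n)) = χ x := by
    intro a
    induction a with
    | zero => intro x hx; simpa only [Nat.cast_zero, mul_zero, Prod.mk_zero_zero, add_zero, and_true] using hx
    | succ a ih =>
      intro x hx
      obtain ⟨h1, h2⟩ := ih x hx
      obtain ⟨h3, h4⟩ := hstep _ (x + ((1, 2 * a + 1) : TorusSquare m n)) h1 (Or.inl (by simp))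
        (Or.inl (by simp; ring))
      obtain ⟨h5, h6⟩ := hstep _ (x + ((0, 2 * (a + 1 : ℕ)) : TorusSquare m n)) h3 (Or.inr (by simp))
        (Or.inl (by simp; ring))
      exact ⟨h5, by rw [h6, h4, h2, Bool.not_not]⟩
  have hb : ((0, 1) : TorusSquare m n) ∈ Set.range (wrap m n) := by rw [hmem]; simp
  obtain ⟨hb', hne⟩ := hstep (0, 1) (1, 0) hb (Or.inl (by simp)) (Or.inr (by simp))
  have hall : ∀ x : TorusSquare m n, x ∈ Set.range (wrap m n) →
      (parity m x.1 = 0 ∧ χ x = χ (0, 1)) ∨ (parity m x.1 = 1 ∧ χ x = !χ (0, 1)) := by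
    rintro ⟨x, y⟩ hx
    rw [hmem] at hx
    obtain ⟨i, hi, rfl⟩ := exists_natCast_eq hm x
    obtain ⟨j, hj, rfl⟩ := exists_natCast_eq hn y
    simp only [map_natCast] at hx ⊢
    rw [← Nat.cast_add, natCast_zmod_two_eq_one] at hx
    rcases Nat.even_or_odd i with hi' | hi'
    · left
      refine ⟨(ZMod.natCast_eq_zero_iff_even).2 hi', ?_⟩
      obtain ⟨a, rfl⟩ := hi'
      obtain ⟨b, rfl⟩ : Odd j := by
        rw [Nat.odd_add] at hx
        by_contra h
        rw [Nat.not_odd_iff_even, ← hx] at h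
        exact (Nat.not_odd_iff_even.2 ⟨a, rfl⟩) h
      obtain ⟨h1, h2⟩ := hrow a _ hb
      obtain ⟨-, h3⟩ := hcol b _ h1
      rw [← h2, ← h3]
      congr 1
      simp only [Prod.mk_add_mk, Prod.mk.injEq]
      constructor <;> push_cast <;> ring
    · right
      refine ⟨natCast_zmod_two_eq_one.2 hi', ?_⟩
      obtain ⟨b, rfl⟩ : Even j := (Nat.odd_add.1 hx).1 hi'
      obtain ⟨a, rfl⟩ := hi'
      obtain ⟨h1, h2⟩ := hrow a _ hb'
      obtain ⟨-, h3⟩ := hcol b _ h1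
      rw [← hne, ← h2, ← h3]
      congr 1
      simp only [Prod.mk_add_mk, Prod.mk.injEq]
      constructor <;> push_cast <;> ring
  refine ⟨if χ (0, 1) = true then 0 else 1, fun v => ?_⟩
  rw [← hval]
  rcases hall v.1 v.2 with ⟨h1, h2⟩ | ⟨h1, h2⟩ <;> rw [h1, h2] <;> cases χ (0, 1) <;> simp

/-! ### Windows as unions of two grids with step 2. -/

/-- The arithmetic progression `z, z + 2, …` with `t` terms. -/
def seg {N : ℕ} (z : ZMod N) (t : ℕ) : Set (ZMod N) := {x | ∃ a : ℕ, a < t ∧ x = z + 2 * a}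

lemma mem_seg {N : ℕ} {z x : ZMod N} {t : ℕ} : x ∈ seg z t ↔ ∃ a : ℕ, a < t ∧ x = z + 2 * a :=
  Iff.rfl

lemma parity_of_mem_seg {m : ℕ} {z x : ZMod (2 * m)} {t : ℕ} (h : x ∈ seg z t) :
    parity m x = parity m z := by
  obtain ⟨a, -, rfl⟩ := h
  rw [map_add, map_mul, map_ofNat, zmod_two_two, zero_mul, add_zero]

lemma add_mem_seg {N : ℕ} {z x y : ZMod N} {t : ℕ} : x + y ∈ seg z t ↔ x ∈ seg (z - y) t := by
  simp only [mem_seg]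
  refine exists_congr fun a => and_congr_right fun _ => ?_
  constructor <;> intro h <;> linear_combination h

lemma mem_seg_sub_one {N : ℕ} {z x : ZMod N} {t : ℕ} :
    x ∈ seg (z - 1) (t + 2) ↔ x - 1 ∈ seg z (t + 1) ∨ x + 1 ∈ seg z (t + 1) := by
  constructor
  · rintro ⟨a, ha, rfl⟩
    rcases Nat.eq_zero_or_pos a with rfl | h
    · right
      exact ⟨0, by omega, by push_cast; ring⟩
    · left
      obtain ⟨b, rfl⟩ : ∃ b, a = b + 1 := ⟨a - 1, by omega⟩
      exact ⟨b, by omega, by push_cast; ring⟩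
  · rintro (⟨a, ha, h⟩ | ⟨a, ha, h⟩)
    · exact ⟨a + 1, by omega, by push_cast; linear_combination h⟩
    · exact ⟨a, by omega, by linear_combination h⟩

lemma mem_both_of_mem_seg {N : ℕ} {z x : ZMod N} {t : ℕ} (hx : x ∈ seg (z + 1) t) :
    x - 1 ∈ seg z (t + 1) ∧ x + 1 ∈ seg z (t + 1) := by
  obtain ⟨a, ha, rfl⟩ := hx
  exact ⟨⟨a, by omega, by ring⟩, ⟨a + 1, by omega, by push_cast; ring⟩⟩

/-- If `t + 1 = m`, the longer progression fills a whole parity class, and the gap between its last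
and first terms would also have both neighbours in it. The bound excludes this. -/
lemma mem_seg_add_one {m : ℕ} {z x : ZMod (2 * m)} {t : ℕ} (ht : t + 1 < m) :
    x ∈ seg (z + 1) t ↔ x - 1 ∈ seg z (t + 1) ∧ x + 1 ∈ seg z (t + 1) := by
  refine ⟨mem_both_of_mem_seg, ?_⟩
  rintro ⟨⟨a, ha, h1⟩, ⟨b, hb, h2⟩⟩
  have h3 : ((2 * a + 2 : ℤ) : ZMod (2 * m)) = ((2 * b : ℤ) : ZMod (2 * m)) := by
    push_cast
    linear_combination h2 - h1
  have h4 := intCast_eq_of_lt h3 (by push_cast; omega) (by push_cast; omega)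
  exact ⟨a, by omega, by linear_combination h1⟩

lemma seg_index_unique {m : ℕ} {z : ZMod (2 * m)} {a b : ℕ} (ha : a < m) (hb : b < m)
    (h : z + 2 * a = z + 2 * b) : a = b := by
  have h3 : ((2 * a : ℤ) : ZMod (2 * m)) = ((2 * b : ℤ) : ZMod (2 * m)) := by
    push_cast
    linear_combination h
  have h4 := intCast_eq_of_lt h3 (by push_cast; omega) (by push_cast; omega)
  omega

/-- The two coordinates of a black board square have equal parity: the even-even squares form the
larger grid, the odd-odd ones the smaller. -/
lemma mem_window {m n k l : ℕ} {c : TorusSquare m n} {v : ToroidalVertex m n} :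
    v ∈ window k l c ↔
      (v.1.1 ∈ seg (c.1 - (k : ZMod (2 * m))) (k + 1) ∧ v.1.2 ∈ seg (c.2 - (l : ZMod (2 * n))) (l + 1)) ∨
      (v.1.1 ∈ seg (c.1 - (k : ZMod (2 * m)) + 1) k ∧ v.1.2 ∈ seg (c.2 - (l : ZMod (2 * n)) + 1) l) := by
  constructor
  · rintro ⟨⟨⟨i, j⟩, hi, hj, hij⟩, h⟩
    rw [h]
    simp only at hi hj hij
    rcases Nat.even_or_odd i with hi' | hi'
    · left
      have hj' : Even j := (Nat.even_add.1 hij).1 hi'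
      obtain ⟨a, rfl⟩ := hi'
      obtain ⟨b, rfl⟩ := hj'
      exact ⟨⟨a, by omega, by simp only [place]; push_cast; ring⟩,
        ⟨b, by omega, by simp only [place]; push_cast; ring⟩⟩
    · right
      have hj' : Odd j := by
        rw [Nat.even_add, ← not_iff_not, Nat.not_even_iff_odd, Nat.not_even_iff_odd] at hij
        exact hij.1 hi'
      obtain ⟨a, rfl⟩ := hi'
      obtain ⟨b, rfl⟩ := hj'
      exact ⟨⟨a, by omega, by simp only [place]; push_cast; ring⟩,
        ⟨b, by omega, by simp only [place]; push_cast; ring⟩⟩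
  · rintro (⟨⟨a, ha, h1⟩, ⟨b, hb, h2⟩⟩ | ⟨⟨a, ha, h1⟩, ⟨b, hb, h2⟩⟩)
    · refine ⟨⟨(2 * a, 2 * b), by simp; omega, by simp; omega, by simp [Nat.even_add]⟩, ?_⟩
      refine Prod.ext ?_ ?_
      · rw [h1]; simp only [place]; push_cast; ring
      · rw [h2]; simp only [place]; push_cast; ring
    · refine ⟨⟨(2 * a + 1, 2 * b + 1), by simp; omega, by simp; omega,
        by simp [Nat.even_add]⟩, ?_⟩
      refine Prod.ext ?_ ?_
      · rw [h1]; simp only [place]; push_cast; ring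
      · rw [h2]; simp only [place]; push_cast; ring

/-- A board with `m ≤ k` or `n ≤ l` would lay two distinct vertices, a full period apart, on the
same square. -/
lemma IsWindow.lt {m n k l : ℕ} (hm : 0 < m) (hn : 0 < n) {c : TorusSquare m n}
    (h : IsWindow k l c) : k < m ∧ l < n := by
  obtain ⟨f, hf⟩ := h
  constructor <;> by_contra! hlt
  · have e : f ⟨(0, 0), by simp⟩ = f ⟨(2 * m, 0), by simpa using hlt, by simp, by simp⟩ := by
      refine Subtype.ext ?_
      rw [hf, hf]
      have : ((2 * m : ℕ) : ZMod (2 * m)) = 0 := ZMod.natCast_self _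
      simp only [place, this, Nat.cast_zero]
    have := congrArg (fun p => p.1.1) (f.injective e)
    simp only at this
    omega
  · have e : f ⟨(0, 0), by simp⟩ = f ⟨(0, 2 * n), by simp, by simpa using hlt, by simp⟩ := by
      refine Subtype.ext ?_
      rw [hf, hf]
      have : ((2 * n : ℕ) : ZMod (2 * n)) = 0 := ZMod.natCast_self _
      simp only [place, this, Nat.cast_zero]
    have := congrArg (fun p => p.1.2) (f.injective e)
    simp only at this
    omega

lemma IsWindow.parity_add {m n k l : ℕ} (hm : 0 < m) (hn : 0 < n) {c : TorusSquare m n}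
    (h : IsWindow k l c) : parity m (c.1 - k) + parity n (c.2 - l) = 1 := by
  obtain ⟨f, hf⟩ := h
  have h1 := (mem_range_wrap hm hn _).1 (f ⟨(0, 0), by simp⟩).2
  rw [hf] at h1
  simp only [place, Nat.cast_zero, zero_sub] at h1
  simpa only [← sub_eq_add_neg] using h1

lemma isNext_place_iff {m k : ℕ} {i j : ℕ} {c : ZMod (2 * m)} (hi : i ≤ 2 * k) (hj : j ≤ 2 * k)
    (hk : k < m) :
    IsNext (c + ((i : ZMod (2 * m)) - (k : ZMod (2 * m)))) (c + ((j : ZMod (2 * m)) - (k : ZMod (2 * m)))) ↔ |(i : ℤ) - j| = 1 := by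
  constructor
  · rintro (h | h)
    · have h3 : ((j : ℤ) : ZMod (2 * m)) = ((i + 1 : ℤ) : ZMod (2 * m)) := by
        push_cast
        linear_combination h
      have := intCast_eq_of_lt h3 (by push_cast; omega) (by push_cast; omega)
      rw [this]; simp
    · have h3 : ((j : ℤ) : ZMod (2 * m)) = ((i - 1 : ℤ) : ZMod (2 * m)) := by
        push_cast
        linear_combination h
      have := intCast_eq_of_lt h3 (by push_cast; omega) (by push_cast; omega)
      rw [this]; simp
  · intro h
    rcases isNext_of_abs (N := 2 * m) h with h | h
    · left; linear_combination h
    · right; linear_combination h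

lemma isWindow_of_lt {m n k l : ℕ} (hm : 0 < m) (hn : 0 < n) {c : TorusSquare m n}
    (hk : k < m) (hl : l < n) (hc : parity m (c.1 - k) + parity n (c.2 - l) = 1) :
    IsWindow k l c := by
  have hmem : ∀ p : BlackSquare k l, place k l c p.1 ∈ Set.range (wrap m n) := by
    rintro ⟨⟨i, j⟩, hi, hj, hij⟩
    rw [mem_range_wrap hm hn]
    have h2 : ((i + j : ℕ) : ZMod 2) = 0 := (ZMod.natCast_eq_zero_iff_even).2 hij
    simp only [place, map_add, map_sub, map_natCast] at hc ⊢
    push_cast at h2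
    linear_combination hc + h2
  have hinj : ∀ (M r i j : ℕ) (z : ZMod (2 * M)), r < M → i ≤ 2 * r → j ≤ 2 * r →
      z + ((i : ZMod (2 * M)) - r) = z + ((j : ZMod (2 * M)) - r) → i = j := by
    intro M r i j z hr hi hj h
    have h3 : ((i : ℤ) : ZMod (2 * M)) = ((j : ℤ) : ZMod (2 * M)) := by
      push_cast
      linear_combination h
    exact_mod_cast intCast_eq_of_lt h3 (by push_cast; omega) (by push_cast; omega)
  refine ⟨⟨⟨fun p => ⟨place k l c p.1, hmem p⟩, ?_⟩, ?_⟩, fun p => rfl⟩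
  · rintro ⟨⟨i, j⟩, hi, hj, hij⟩ ⟨⟨i', j'⟩, hi', hj', hij'⟩ h
    have h1 := congrArg Subtype.val h
    simp only [place, Prod.mk.injEq] at h1
    have h2 := hinj _ _ _ _ _ hk hi hi' h1.1
    have h3 := hinj _ _ _ _ _ hl hj hj' h1.2
    simp only at h2 h3
    subst h2 h3
    rfl
  · rintro ⟨⟨i, j⟩, hi, hj, hij⟩ ⟨⟨i', j'⟩, hi', hj', hij'⟩
    change (toroidalAztecRectangle m n).Adj _ _ ↔ ShareCorner _ _
    rw [toroidal_adj hm hn]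
    exact and_congr (isNext_place_iff hi hi' hk) (isNext_place_iff hj hj' hl)

/-! ### The decomposition of the torus into 4-cycles. -/

/-- The squares whose row and column both have parity `ε`. -/
abbrev CellSquare (m n : ℕ) (ε : ZMod 2) : Type :=
  {x : TorusSquare m n // parity m x.1 = ε ∧ parity n x.2 = ε}

lemma zmod_two_add_self (ε : ZMod 2) : ε + ε = 0 := by revert ε; decide

lemma parity_two (m : ℕ) : parity m 2 = 0 := by
  rw [map_ofNat, zmod_two_two]

/-- Translation of the cells by two columns. -/
def colShift (m n : ℕ) (ε : ZMod 2) : Equiv.Perm (CellSquare m n ε) where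
  toFun x := ⟨(x.1.1, x.1.2 + 2), x.2.1, by simp [x.2.2, parity_two]⟩
  invFun x := ⟨(x.1.1, x.1.2 - 2), x.2.1, by simp [x.2.2, parity_two]⟩
  left_inv x := by simp
  right_inv x := by simp

/-- Translation of the cells by two rows. -/
def rowShift (m n : ℕ) (ε : ZMod 2) : Equiv.Perm (CellSquare m n ε) where
  toFun x := ⟨(x.1.1 + 2, x.1.2), by simp [x.2.1, parity_two], x.2.2⟩
  invFun x := ⟨(x.1.1 - 2, x.1.2), by simp [x.2.1, parity_two], x.2.2⟩
  left_inv x := by simp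
  right_inv x := by simp

section Vertices

variable {m n : ℕ} (hm : 0 < m) (hn : 0 < n) {ε : ZMod 2}

/-- The vertex to the right of a cell. -/
def eastVertex (x : CellSquare m n ε) : ToroidalVertex m n :=
  ⟨(x.1.1, x.1.2 + 1), (mem_range_wrap hm hn _).2 <| by
    simp only [map_add, map_one, x.2.1, x.2.2, ← add_assoc, zmod_two_add_self, zero_add]⟩

/-- The vertex below a cell. -/
def southVertex (x : CellSquare m n ε) : ToroidalVertex m n :=
  ⟨(x.1.1 + 1, x.1.2), (mem_range_wrap hm hn _).2 <| by
    simp only [map_add, map_one, x.2.1, x.2.2]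
    linear_combination zmod_two_add_self ε⟩

lemma cellVertex_eastVertex (x : CellSquare m n ε) (a : Bool) :
    (cellVertex (colShift m n ε) (eastVertex hm hn) x a).1 =
      (x.1.1, x.1.2 + bif a then 1 else -1) := by
  cases a
  · simp only [cellVertex, eastVertex, colShift, cond_false, Equiv.coe_fn_symm_mk, Prod.mk.injEq,
      true_and]
    ring
  · rfl

lemma cellVertex_southVertex (x : CellSquare m n ε) (a : Bool) :
    (cellVertex (rowShift m n ε) (southVertex hm hn) x a).1 =
      (x.1.1 + bif a then 1 else -1, x.1.2) := by
  cases a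
  · simp only [cellVertex, southVertex, rowShift, cond_false, Equiv.coe_fn_symm_mk, Prod.mk.injEq,
      and_true]
    ring
  · rfl

lemma bool_eq_of_sign_eq {m : ℕ} (hm : 1 < m) {a b : Bool}
    (h : (bif a then 1 else -1 : ZMod (2 * m)) = bif b then 1 else -1) : a = b := by
  have h1 : (1 : ZMod (2 * m)) ≠ -1 := by
    intro h
    have h3 : ((1 : ℤ) : ZMod (2 * m)) = ((-1 : ℤ) : ZMod (2 * m)) := by
      push_cast
      exact h
    have := intCast_eq_of_lt h3 (by push_cast; omega) (by push_cast; omega)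
    omega
  revert h
  cases a <;> cases b <;> simp [h1, h1.symm]

lemma isNext_iff_sign {N : ℕ} {x y : ZMod N} :
    IsNext x y ↔ ∃ a : Bool, y = x + bif a then 1 else -1 := by
  simp [IsNext, sub_eq_add_neg, or_comm]

lemma zmod_two_eq_add_one_of_ne : ∀ {x y : ZMod 2}, x ≠ y → x = y + 1 := by decide

/-- The cell of an edge sits in the row of its horizontal end and the column of its vertical end.
The bounds `m, n > 1` give `1 ≠ -1`, so that the four vertices around a cell are distinct. -/
theorem isCellGraph_toroidal (hm' : 1 < m) (hn' : 1 < n) (ε : ZMod 2) :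
    IsCellGraph (toroidalAztecRectangle m n) (colShift m n ε) (rowShift m n ε)
      (eastVertex hm hn) (southVertex hm hn) where
  injA x y h := by
    have h := congrArg Subtype.val h
    simp only [eastVertex, Prod.mk.injEq, add_left_inj] at h
    exact Subtype.ext (Prod.ext h.1 h.2)
  injB x y h := by
    have h := congrArg Subtype.val h
    simp only [southVertex, Prod.mk.injEq, add_left_inj] at h
    exact Subtype.ext (Prod.ext h.1 h.2)
  ne x y h := by
    have h := congrArg (fun v => parity m v.1.1) h
    simp [eastVertex, southVertex, x.2.1, y.2.1] at h
  surj v := by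
    have hv := (mem_range_wrap hm hn _).1 v.2
    by_cases h : parity m v.1.1 = ε
    · left
      refine ⟨⟨(v.1.1, v.1.2 - 1), h, ?_⟩, Subtype.ext (Prod.ext rfl ?_)⟩
      · simp only [map_sub, map_one]
        linear_combination hv - h - zmod_two_add_self ε
      · simp [eastVertex]
    · right
      have h := zmod_two_eq_add_one_of_ne h
      refine ⟨⟨(v.1.1 - 1, v.1.2), ?_, ?_⟩, Subtype.ext (Prod.ext ?_ rfl)⟩
      · simp [h]
      · linear_combination hv - h - zmod_two_add_self ε
      · simp [southVertex]
  adj_iff u v := by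
    rw [toroidal_adj hm hn]
    have key : ∀ u v : ToroidalVertex m n, parity m u.1.1 = ε → IsNext u.1.1 v.1.1 →
        IsNext u.1.2 v.1.2 → ∃ c a b,
          u = cellVertex (colShift m n ε) (eastVertex hm hn) c a ∧
          v = cellVertex (rowShift m n ε) (southVertex hm hn) c b := by
      intro u v hu h1 h2
      have hv := (mem_range_wrap hm hn _).1 v.2
      rw [h1.parity_eq, hu] at hv
      obtain ⟨a, ha⟩ := isNext_iff_sign.1 h2.symm
      obtain ⟨b, hb⟩ := isNext_iff_sign.1 h1
      refine ⟨⟨(u.1.1, v.1.2), hu, ?_⟩, a, b, Subtype.ext ?_, Subtype.ext ?_⟩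
      · linear_combination hv - zmod_two_add_self ε
      · rw [cellVertex_eastVertex]
        exact Prod.ext rfl ha
      · rw [cellVertex_southVertex]
        exact Prod.ext hb rfl
    constructor
    · rintro ⟨h1, h2⟩
      by_cases hu : parity m u.1.1 = ε
      · obtain ⟨c, a, b, h⟩ := key u v hu h1 h2
        exact ⟨c, a, b, Or.inl h⟩
      · have hv : parity m v.1.1 = ε := by
          rw [h1.parity_eq, zmod_two_eq_add_one_of_ne hu, add_assoc, zmod_two_add_self, add_zero]
        obtain ⟨c, a, b, h⟩ := key v u hv h1.symm h2.symm
        exact ⟨c, a, b, Or.inr h.symm⟩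
    · have key' : ∀ (c : CellSquare m n ε) (a b : Bool),
          IsNext (cellVertex (colShift m n ε) (eastVertex hm hn) c a).1.1
            (cellVertex (rowShift m n ε) (southVertex hm hn) c b).1.1 ∧
          IsNext (cellVertex (colShift m n ε) (eastVertex hm hn) c a).1.2
            (cellVertex (rowShift m n ε) (southVertex hm hn) c b).1.2 := by
        intro c a b
        rw [cellVertex_eastVertex, cellVertex_southVertex]
        exact ⟨isNext_iff_sign.2 ⟨b, rfl⟩, (isNext_iff_sign.2 ⟨a, rfl⟩).symm⟩
      rintro ⟨c, a, b, ⟨rfl, rfl⟩ | ⟨rfl, rfl⟩⟩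
      · exact key' c a b
      · exact ⟨(key' c a b).1.symm, (key' c a b).2.symm⟩
  edge_inj c c' a a' b b' h1 h2 := by
    have h1 := congrArg Subtype.val h1
    have h2 := congrArg Subtype.val h2
    rw [cellVertex_eastVertex, cellVertex_eastVertex, Prod.mk.injEq] at h1
    rw [cellVertex_southVertex, cellVertex_southVertex, Prod.mk.injEq] at h2
    obtain rfl : c = c' := Subtype.ext (Prod.ext h1.1 h2.2)
    exact ⟨rfl, bool_eq_of_sign_eq hn' (add_left_cancel h1.2),
      bool_eq_of_sign_eq hm' (add_left_cancel h2.1)⟩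

end Vertices

/-! ### Windows described by their blocks of cells. -/

/-- The cells that separate the windows `O_{k,q+1}` and `O_{k+1,q}` with centre `c`. -/
def windowCells {m n : ℕ} (k q : ℕ) (c : TorusSquare m n) : Set (TorusSquare m n) :=
  {x | x.1 ∈ seg (c.1 - (k : ZMod (2 * m))) (k + 1) ∧
    x.2 ∈ seg (c.2 - (q : ZMod (2 * n))) (q + 1)}

section Windows

variable {m n k q : ℕ} {c : TorusSquare m n} {v : ToroidalVertex m n}

lemma mem_window_succ_right_of_parity_eq (hv : parity m v.1.1 = parity m (c.1 - k)) :
    v ∈ window k (q + 1) c ↔ v.1.1 ∈ seg (c.1 - (k : ZMod (2 * m))) (k + 1) ∧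
      v.1.2 ∈ seg (c.2 - (q : ZMod (2 * n)) - 1) (q + 2) := by
  rw [mem_window, or_iff_left, Nat.cast_succ, sub_add_eq_sub_sub]
  rintro ⟨h, -⟩
  have := parity_of_mem_seg h
  rw [hv, map_add] at this
  simp at this

lemma mem_window_succ_left_of_parity_eq (hv : parity m v.1.1 = parity m (c.1 - k)) :
    v ∈ window (k + 1) q c ↔ v.1.1 ∈ seg (c.1 - (k : ZMod (2 * m))) (k + 1) ∧
      v.1.2 ∈ seg (c.2 - (q : ZMod (2 * n)) + 1) q := by
  rw [mem_window, or_iff_right, Nat.cast_succ, sub_add_eq_sub_sub, sub_add_cancel]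
  rintro ⟨h, -⟩
  have := parity_of_mem_seg h
  rw [hv, Nat.cast_succ, sub_add_eq_sub_sub, map_sub _ (c.1 - (k : ZMod (2 * m))), map_one]
    at this
  exact one_ne_zero (sub_eq_self.1 this.symm)

lemma mem_window_succ_right_of_parity_ne (hv : parity m v.1.1 = parity m (c.1 - k) + 1) :
    v ∈ window k (q + 1) c ↔ v.1.1 ∈ seg (c.1 - (k : ZMod (2 * m)) + 1) k ∧
      v.1.2 ∈ seg (c.2 - (q : ZMod (2 * n))) (q + 1) := by
  rw [mem_window, or_iff_right, Nat.cast_succ, sub_add_eq_sub_sub, sub_add_cancel]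
  rintro ⟨h, -⟩
  have := parity_of_mem_seg h
  rw [hv] at this
  simp at this

lemma mem_window_succ_left_of_parity_ne (hv : parity m v.1.1 = parity m (c.1 - k) + 1) :
    v ∈ window (k + 1) q c ↔ v.1.1 ∈ seg (c.1 - (k : ZMod (2 * m)) - 1) (k + 2) ∧
      v.1.2 ∈ seg (c.2 - (q : ZMod (2 * n))) (q + 1) := by
  rw [mem_window, or_iff_left, Nat.cast_succ, sub_add_eq_sub_sub]
  rintro ⟨h, -⟩
  have := parity_of_mem_seg h
  rw [hv, Nat.cast_succ, sub_add_eq_sub_sub, sub_add_cancel] at this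
  simp at this

lemma mem_window_succ_right_iff_or (hv : parity m v.1.1 = parity m (c.1 - k)) :
    v ∈ window k (q + 1) c ↔
      (v.1.1, v.1.2 - 1) ∈ windowCells k q c ∨ (v.1.1, v.1.2 + 1) ∈ windowCells k q c := by
  rw [mem_window_succ_right_of_parity_eq hv, mem_seg_sub_one, and_or_left]
  rfl

lemma mem_windowCells_of_mem_window_succ_left (hv : parity m v.1.1 = parity m (c.1 - k))
    (h : v ∈ window (k + 1) q c) :
    (v.1.1, v.1.2 - 1) ∈ windowCells k q c ∧ (v.1.1, v.1.2 + 1) ∈ windowCells k q c := by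
  rw [mem_window_succ_left_of_parity_eq hv] at h
  have := mem_both_of_mem_seg h.2
  exact ⟨⟨h.1, this.1⟩, ⟨h.1, this.2⟩⟩

/-- The implication from left to right always holds. The converse needs a block that does not close
up around the torus, whence the bound. -/
lemma mem_window_succ_left_iff_and (hv : parity m v.1.1 = parity m (c.1 - k)) (hq : q + 1 < n) :
    v ∈ window (k + 1) q c ↔
      (v.1.1, v.1.2 - 1) ∈ windowCells k q c ∧ (v.1.1, v.1.2 + 1) ∈ windowCells k q c := by
  rw [mem_window_succ_left_of_parity_eq hv, mem_seg_add_one hq, and_and_left]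
  rfl

lemma mem_window_succ_left_iff_or (hv : parity m v.1.1 = parity m (c.1 - k) + 1) :
    v ∈ window (k + 1) q c ↔
      (v.1.1 - 1, v.1.2) ∈ windowCells k q c ∨ (v.1.1 + 1, v.1.2) ∈ windowCells k q c := by
  rw [mem_window_succ_left_of_parity_ne hv, mem_seg_sub_one, or_and_right]
  rfl

lemma mem_windowCells_of_mem_window_succ_right (hv : parity m v.1.1 = parity m (c.1 - k) + 1)
    (h : v ∈ window k (q + 1) c) :
    (v.1.1 - 1, v.1.2) ∈ windowCells k q c ∧ (v.1.1 + 1, v.1.2) ∈ windowCells k q c := by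
  rw [mem_window_succ_right_of_parity_ne hv] at h
  have := mem_both_of_mem_seg h.1
  exact ⟨⟨this.1, h.2⟩, ⟨this.2, h.2⟩⟩

lemma mem_window_succ_right_iff_and (hv : parity m v.1.1 = parity m (c.1 - k) + 1)
    (hk : k + 1 < m) :
    v ∈ window k (q + 1) c ↔
      (v.1.1 - 1, v.1.2) ∈ windowCells k q c ∧ (v.1.1 + 1, v.1.2) ∈ windowCells k q c := by
  rw [mem_window_succ_right_of_parity_ne hv, mem_seg_add_one hk, and_and_right]
  rfl

/-- The majority of the vertices of a window are in the rows of its corners. -/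
lemma ncard_parity_ne_le {k l : ℕ} (hm : 0 < m) (hn : 0 < n) (c : TorusSquare m n) :
    {v ∈ window k l c | parity m v.1.1 ≠ parity m (c.1 - k)}.ncard ≤
      {v ∈ window k l c | parity m v.1.1 = parity m (c.1 - k)}.ncard := by
  have : NeZero (2 * m) := ⟨by omega⟩
  have : NeZero (2 * n) := ⟨by omega⟩
  -- Translation by `(-1, -1)` injects the smaller grid into the larger one, with no assumption on
  -- how the board wraps.
  have hv : ∀ v : ToroidalVertex m n, (v.1 - 1 : TorusSquare m n) ∈ Set.range (wrap m n) := by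
    intro v
    have h := (mem_range_wrap hm hn _).1 v.2
    rw [mem_range_wrap hm hn]
    simp only [Prod.fst_sub, Prod.snd_sub, Prod.fst_one, Prod.snd_one, map_sub, map_one]
    linear_combination h - zmod_two_add_self 1
  refine Set.ncard_le_ncard_of_injOn (fun v => ⟨v.1 - 1, hv v⟩) ?_ ?_ (Set.toFinite _)
  · rintro v ⟨h1, h2⟩
    rw [mem_window] at h1
    rcases h1 with ⟨h1, -⟩ | ⟨h1, h3⟩
    · exact absurd (parity_of_mem_seg h1) h2
    · have h4 : v.1.1 - 1 ∈ seg (c.1 - (k : ZMod (2 * m))) (k + 1) := (mem_both_of_mem_seg h1).1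
      exact ⟨mem_window.2 (Or.inl ⟨h4, (mem_both_of_mem_seg h3).1⟩), parity_of_mem_seg h4⟩
  · intro v _ w _ h
    have h := congrArg Subtype.val h
    simp only [sub_left_inj] at h
    exact Subtype.ext h

/-- Otherwise the white vertices would form the smaller grid, against their strict majority. -/
lemma WhitePlaced.parity_eq {k l : ℕ} (hm : 0 < m) (hn : 0 < n)
    {col : (toroidalAztecRectangle m n).Coloring Bool} {ε : ZMod 2}
    (hε : ∀ v : ToroidalVertex m n, col v = true ↔ parity m v.1.1 = ε)
    (h : WhitePlaced col (window k l c)) : parity m (c.1 - k) = ε := by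
  by_contra hne
  have h0 : ε = parity m (c.1 - k) + 1 := zmod_two_eq_add_one_of_ne (Ne.symm hne)
  refine absurd (ncard_parity_ne_le (k := k) (l := l) hm hn c) (not_le.2 ?_)
  have e : ∀ x y : ZMod 2, x = y + 1 ↔ x ≠ y := by decide
  have e' : ∀ x y : ZMod 2, x ≠ y + 1 ↔ x = y := by decide
  simpa only [WhitePlaced, ← Bool.not_eq_true, hε, h0, e, e', ← ne_eq, not_not] using h

lemma BlackPlaced.parity_eq {k l : ℕ} (hm : 0 < m) (hn : 0 < n)
    {col : (toroidalAztecRectangle m n).Coloring Bool} {ε : ZMod 2}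
    (hε : ∀ v : ToroidalVertex m n, col v = true ↔ parity m v.1.1 = ε)
    (h : BlackPlaced col (window k l c)) : parity m (c.1 - k) = ε + 1 := by
  by_contra hne
  have e0 : ∀ x y : ZMod 2, x ≠ y + 1 → y = x := by decide
  obtain rfl := e0 _ _ hne
  refine absurd (ncard_parity_ne_le (k := k) (l := l) hm hn c) (not_le.2 ?_)
  simpa only [BlackPlaced, ← Bool.not_eq_true, hε, ← ne_eq] using h

/-- The number of cells in a rectangle. -/
lemma card_cells_seg {ε : ZMod 2} {z : ZMod (2 * m)} {w : ZMod (2 * n)} {s t : ℕ} (hs : s ≤ m)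
    (ht : t ≤ n) (hz : parity m z = ε) (hw : parity n w = ε) :
    Nat.card {x : CellSquare m n ε // x.1.1 ∈ seg z s ∧ x.1.2 ∈ seg w t} = s * t := by
  have hp : ∀ (M a : ℕ) (z : ZMod (2 * M)), parity M (z + 2 * a) = parity M z :=
    fun M a z => parity_of_mem_seg ⟨a, Nat.lt_succ_self a, rfl⟩
  rw [← Nat.card_eq_of_bijective (fun p : Fin s × Fin t =>
    (⟨⟨(z + 2 * (p.1 : ℕ), w + 2 * (p.2 : ℕ)), by rw [hp, hz], by rw [hp, hw]⟩,
      ⟨p.1, p.1.2, rfl⟩, ⟨p.2, p.2.2, rfl⟩⟩ :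
      {x : CellSquare m n ε // x.1.1 ∈ seg z s ∧ x.1.2 ∈ seg w t})) ⟨?_, ?_⟩]
  · simp
  · rintro ⟨a, b⟩ ⟨a', b'⟩ h
    have h := congrArg (fun x => x.1.1) h
    simp only [Prod.mk.injEq] at h
    exact Prod.ext (Fin.ext (seg_index_unique (a.2.trans_le hs) (a'.2.trans_le hs) h.1))
      (Fin.ext (seg_index_unique (b.2.trans_le ht) (b'.2.trans_le ht) h.2))
  · rintro ⟨⟨⟨x, y⟩, hx⟩, ⟨a, ha, h1⟩, ⟨b, hb, h2⟩⟩
    refine ⟨(⟨a, ha⟩, ⟨b, hb⟩), Subtype.ext (Subtype.ext (Prod.ext h1.symm h2.symm))⟩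

lemma card_iUnion_of_disjoint {α ι : Type*} [Finite α] [Fintype ι] {P : ι → α → Prop}
    (h : ∀ x i j, P i x → P j x → i = j) :
    Nat.card {x // ∃ i, P i x} = ∑ i, Nat.card {x // P i x} := by
  rw [← Nat.card_sigma]
  refine Nat.card_congr (Equiv.ofBijective
    (fun p : (Σ i, {x // P i x}) => (⟨p.2.1, p.1, p.2.2⟩ : {x // ∃ i, P i x})) ⟨?_, ?_⟩).symm
  · rintro ⟨i, x, hx⟩ ⟨j, y, hy⟩ he
    obtain rfl : x = y := congrArg Subtype.val he
    obtain rfl := h x i j hx hy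
    rfl
  · rintro ⟨x, i, hx⟩
    exact ⟨⟨i, x, hx⟩, rfl⟩

end Windows

/-! ### Forced removal of vertices, and the combinatorics of the exchange. -/

section Exchange

variable {V C : Type*}

lemma exists_adj_of_numPerfectMatchings_pos {G : SimpleGraph V} {S : Set V}
    (h : 0 < numPerfectMatchings (G.induce S)) {v : V} (hv : v ∈ S) : ∃ w ∈ S, G.Adj v w := by
  obtain ⟨⟨M, hM⟩⟩ : Nonempty {M : (G.induce S).Subgraph // M.IsPerfectMatching} :=
    (Nat.card_pos_iff.1 h).1
  obtain ⟨w, hw, -⟩ := SimpleGraph.Subgraph.isPerfectMatching_iff.1 hM ⟨v, hv⟩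
  exact ⟨w.1, w.2, M.adj_sub hw⟩

/-- All neighbours of `A c` lie on its two cells. If all of them are removed, a surviving `A c`
could not be matched. -/
lemma IsCellGraph.mem_of_forall_notMem {G : SimpleGraph V} {σ τ : Equiv.Perm C} {A B : C → V}
    (h : IsCellGraph G σ τ A B) {S : Set V} (hS : 0 < numPerfectMatchings (G.induce Sᶜ)) {c : C}
    (h1 : ∀ b, cellVertex τ B c b ∈ S) (h2 : ∀ b, cellVertex τ B (σ c) b ∈ S) : A c ∈ S := by
  by_contra hc
  obtain ⟨w, hw, hadj⟩ := exists_adj_of_numPerfectMatchings_pos hS hc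
  rw [h.adj_iff] at hadj
  obtain ⟨d, a, b, ⟨h3, rfl⟩ | ⟨h3, -⟩⟩ := hadj
  · have hd := h.eq_cond h3
    cases a
    · exact hw (hd ▸ h2 b)
    · exact hw (hd ▸ h1 b)
  · exact h.ne _ _ h3

/-- A family of vertex sets `W₁, W₂`, a family of sets of cells `Z₁, Z₂` and the complementary
vertex sets `W₁', W₂'`, as seen at the vertices `A c`: the sets `W₁` and `W₂'` consist of the
vertices on some cell, `W₁'` and `W₂` of the vertices with both cells in the set of cells. -/
structure IsExchange {ι : Type*} (σ : Equiv.Perm C) (A : C → V) (Z₁ Z₂ : ι → Set C)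
    (W₁ W₂ W₁' W₂' : ι → Set V) : Prop where
  mem₁ : ∀ c i, A c ∈ W₁ i ↔ c ∈ Z₁ i ∨ σ c ∈ Z₁ i
  mem₂ : ∀ c i, A c ∈ W₂ i ↔ c ∈ Z₂ i ∧ σ c ∈ Z₂ i
  mem₁' : ∀ c i, A c ∈ W₁' i ↔ c ∈ Z₁ i ∧ σ c ∈ Z₁ i
  mem₂' : ∀ c i, A c ∈ W₂' i ↔ c ∈ Z₂ i ∨ σ c ∈ Z₂ i
  unique₁ : ∀ c i j, c ∈ Z₁ i → c ∈ Z₁ j → i = j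
  unique₂ : ∀ c i j, c ∈ Z₂ i → c ∈ Z₂ j → i = j
  disjoint : ∀ c i j, c ∈ Z₁ i → c ∉ Z₂ j
  next₁ : ∀ c i j, c ∈ Z₁ i → σ c ∈ Z₁ j → i = j
  next₂ : ∀ c i j, c ∈ Z₂ i → σ c ∈ Z₂ j → i = j

namespace IsExchange

variable {ι : Type*} {σ : Equiv.Perm C} {A : C → V} {Z₁ Z₂ : ι → Set C}
  {W₁ W₂ W₁' W₂' : ι → Set V} (h : IsExchange σ A Z₁ Z₂ W₁ W₂ W₁' W₂')

include h in
lemma eq₁ {c : C} {i j : ι} (hi : A c ∈ W₁' i) (hj : A c ∈ W₁' j) : i = j := by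
  rw [h.mem₁'] at hi hj
  exact h.unique₁ c i j hi.1 hj.1

include h in
lemma eq₂ {c : C} {i j : ι} (hi : A c ∈ W₂' i) (hj : A c ∈ W₂' j) : i = j := by
  rw [h.mem₂'] at hi hj
  rcases hi with hi | hi <;> rcases hj with hj | hj
  · exact h.unique₂ _ i j hi hj
  · exact h.next₂ c i j hi hj
  · exact (h.next₂ c j i hj hi).symm
  · exact h.unique₂ _ i j hi hj

include h in
lemma false_of_mem {c : C} {i j : ι} (hi : A c ∈ W₁' i) (hj : A c ∈ W₂' j) : False := by
  rw [h.mem₁'] at hi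
  rw [h.mem₂'] at hj
  rcases hj with hj | hj
  · exact h.disjoint _ i j hi.1 hj
  · exact h.disjoint _ i j hi.2 hj

-- Yields the complementarity condition. Since adjacent cells in blocks of one kind belong to the
-- same block, the "both cells" conditions survive the passage to unions over `ι`.
include h in
lemma toNat_add (c : C) {w w' : Bool} {p p' : Prop} [Decidable p] [Decidable p']
    (hw : w = true ↔ ¬((∃ i, A c ∈ W₁ i) ∨ ∃ i, A c ∈ W₂ i))
    (hw' : w' = true ↔ ¬((∃ i, A c ∈ W₁' i) ∨ ∃ i, A c ∈ W₂' i))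
    (hp : p ↔ (∃ i, c ∈ Z₁ i) ∨ ∃ i, c ∈ Z₂ i) (hp' : p' ↔ (∃ i, σ c ∈ Z₁ i) ∨ ∃ i, σ c ∈ Z₂ i) :
    w.toNat + w'.toNat + (if p then 1 else 0) + (if p' then 1 else 0) = 2 := by
  have key : ∀ (x₁ x₂ y₁ y₂ w₁ w₂ w₁' w₂' : Prop), (w = true ↔ ¬(w₁ ∨ w₂)) →
      (w' = true ↔ ¬(w₁' ∨ w₂')) → (p ↔ x₁ ∨ x₂) → (p' ↔ y₁ ∨ y₂) →
      (w₁ ↔ x₁ ∨ y₁) → (w₂' ↔ x₂ ∨ y₂) → (w₁' ↔ x₁ ∧ y₁) → (w₂ ↔ x₂ ∧ y₂) →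
      ¬(x₁ ∧ x₂) → ¬(y₁ ∧ y₂) →
      w.toNat + w'.toNat + (if p then 1 else 0) + (if p' then 1 else 0) = 2 := by
    intro x₁ x₂ y₁ y₂ w₁ w₂ w₁' w₂' e e' f f' h1 h2 h3 h4 h5 h6
    rw [h1, h4] at e
    rw [h3, h2] at e'
    clear hw hw' hp hp'
    classical
    have ew : w = decide ¬((x₁ ∨ y₁) ∨ x₂ ∧ y₂) := by rw [Bool.eq_iff_iff, e, decide_eq_true_iff]
    have ew' : w' = decide ¬(x₁ ∧ y₁ ∨ x₂ ∨ y₂) := by rw [Bool.eq_iff_iff, e', decide_eq_true_iff]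
    rw [ew, ew']
    by_cases x₁ <;> by_cases x₂ <;> by_cases y₁ <;> by_cases y₂ <;> simp_all
  refine key _ _ _ _ _ _ _ _ hw hw' hp hp' ?_ ?_ ?_ ?_ ?_ ?_
  · simp only [h.mem₁, exists_or]
  · simp only [h.mem₂', exists_or]
  · simp only [h.mem₁']
    exact ⟨fun ⟨i, hi⟩ => ⟨⟨i, hi.1⟩, ⟨i, hi.2⟩⟩,
      fun ⟨⟨i, hi⟩, ⟨j, hj⟩⟩ => ⟨i, hi, h.next₁ c i j hi hj ▸ hj⟩⟩
  · simp only [h.mem₂]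
    exact ⟨fun ⟨i, hi⟩ => ⟨⟨i, hi.1⟩, ⟨i, hi.2⟩⟩,
      fun ⟨⟨i, hi⟩, ⟨j, hj⟩⟩ => ⟨i, hi, h.next₂ c i j hi hj ▸ hj⟩⟩
  · rintro ⟨⟨i, hi⟩, ⟨j, hj⟩⟩
    exact h.disjoint _ i j hi hj
  · rintro ⟨⟨i, hi⟩, ⟨j, hj⟩⟩
    exact h.disjoint _ i j hi hj

end IsExchange

end Exchange

/-! ### Horizontal and vertical vertices of a window in terms of cells. -/

section Cells

variable {m n : ℕ} (hm : 0 < m) (hn : 0 < n) {ε : ZMod 2} {k q : ℕ} {c : TorusSquare m n}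

/-- The cells that separate the windows `O_{k,q+1}` and `O_{k+1,q}` with centre `c`. -/
def cellSet (ε : ZMod 2) (k q : ℕ) (c : TorusSquare m n) : Set (CellSquare m n ε) :=
  {x | x.1 ∈ windowCells k q c}

lemma eastVertex_left (x : CellSquare m n ε) :
    ((eastVertex hm hn x).1.1, (eastVertex hm hn x).1.2 - 1) = x.1 := by
  simp [eastVertex]

lemma eastVertex_right (x : CellSquare m n ε) :
    ((eastVertex hm hn x).1.1, (eastVertex hm hn x).1.2 + 1) = (colShift m n ε x).1 := by
  simp [eastVertex, colShift, add_assoc, one_add_one_eq_two]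

lemma southVertex_up (x : CellSquare m n ε) :
    ((southVertex hm hn x).1.1 - 1, (southVertex hm hn x).1.2) = x.1 := by
  simp [southVertex]

lemma southVertex_down (x : CellSquare m n ε) :
    ((southVertex hm hn x).1.1 + 1, (southVertex hm hn x).1.2) = (rowShift m n ε x).1 := by
  simp [southVertex, rowShift, add_assoc, one_add_one_eq_two]

lemma parity_eastVertex (x : CellSquare m n ε) : parity m (eastVertex hm hn x).1.1 = ε := x.2.1

lemma parity_southVertex (x : CellSquare m n ε) :
    parity m (southVertex hm hn x).1.1 = ε + 1 := by
  simp [southVertex, x.2.1]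

variable (hc : parity m (c.1 - k) = ε) (x : CellSquare m n ε)
include hc

lemma eastVertex_mem_or :
    eastVertex hm hn x ∈ window k (q + 1) c ↔
      x ∈ cellSet ε k q c ∨ colShift m n ε x ∈ cellSet ε k q c := by
  rw [mem_window_succ_right_iff_or (by rw [parity_eastVertex, hc]), eastVertex_left,
    eastVertex_right]
  rfl

lemma eastVertex_mem_and (hq : q + 1 < n) :
    eastVertex hm hn x ∈ window (k + 1) q c ↔
      x ∈ cellSet ε k q c ∧ colShift m n ε x ∈ cellSet ε k q c := by
  rw [mem_window_succ_left_iff_and (by rw [parity_eastVertex, hc]) hq, eastVertex_left,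
    eastVertex_right]
  rfl

lemma mem_of_eastVertex_mem (h : eastVertex hm hn x ∈ window (k + 1) q c) :
    x ∈ cellSet ε k q c ∧ colShift m n ε x ∈ cellSet ε k q c := by
  have := mem_windowCells_of_mem_window_succ_left (by rw [parity_eastVertex, hc]) h
  rwa [eastVertex_left, eastVertex_right] at this

lemma southVertex_mem_or :
    southVertex hm hn x ∈ window (k + 1) q c ↔
      x ∈ cellSet ε k q c ∨ rowShift m n ε x ∈ cellSet ε k q c := by
  rw [mem_window_succ_left_iff_or (by rw [parity_southVertex, hc]), southVertex_up,
    southVertex_down]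
  rfl

lemma southVertex_mem_and (hk : k + 1 < m) :
    southVertex hm hn x ∈ window k (q + 1) c ↔
      x ∈ cellSet ε k q c ∧ rowShift m n ε x ∈ cellSet ε k q c := by
  rw [mem_window_succ_right_iff_and (by rw [parity_southVertex, hc]) hk, southVertex_up,
    southVertex_down]
  rfl

lemma mem_of_southVertex_mem (h : southVertex hm hn x ∈ window k (q + 1) c) :
    x ∈ cellSet ε k q c ∧ rowShift m n ε x ∈ cellSet ε k q c := by
  have := mem_windowCells_of_mem_window_succ_right (by rw [parity_southVertex, hc]) h
  rwa [southVertex_up, southVertex_down] at this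

lemma cellVertex_east_mem {x : CellSquare m n ε} (hx : x ∈ cellSet ε k q c) (a : Bool) :
    cellVertex (colShift m n ε) (eastVertex hm hn) x a ∈ window k (q + 1) c := by
  unfold cellVertex
  rw [eastVertex_mem_or hm hn hc]
  cases a
  · right; simpa using hx
  · left; exact hx

lemma cellVertex_south_mem {x : CellSquare m n ε} (hx : x ∈ cellSet ε k q c) (a : Bool) :
    cellVertex (rowShift m n ε) (southVertex hm hn) x a ∈ window (k + 1) q c := by
  unfold cellVertex
  rw [southVertex_mem_or hm hn hc]
  cases a
  · right; simpa using hx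
  · left; exact hx

/-- If the window `O_{k,q+1}` has more than one row of minority vertices, every cell touches one. -/
lemma exists_southVertex_mem (hk : 0 < k) {x : CellSquare m n ε} (hx : x ∈ cellSet ε k q c) :
    ∃ a, cellVertex (rowShift m n ε) (southVertex hm hn) x a ∈ window k (q + 1) c := by
  obtain ⟨⟨a, ha, h1⟩, h2⟩ := hx
  by_cases h0 : a < k
  · refine ⟨true, ?_⟩
    refine (mem_window_succ_right_of_parity_ne (by rw [hc]; exact parity_southVertex hm hn x)).2 ?_
    rw [cellVertex_southVertex]
    exact ⟨⟨a, h0, by rw [h1]; simp only [cond_true]; ring⟩, h2⟩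
  · refine ⟨false, ?_⟩
    refine (mem_window_succ_right_of_parity_ne (by rw [hc]; exact parity_southVertex hm hn _)).2 ?_
    rw [cellVertex_southVertex]
    obtain ⟨b, rfl⟩ : ∃ b, a = b + 1 := ⟨a - 1, by omega⟩
    exact ⟨⟨b, by omega, by rw [h1]; simp only [cond_false]; push_cast; ring⟩, h2⟩

lemma card_cellSet (hk : k < m) (hq : q < n) (hc' : parity n (c.2 - q) = ε) :
    Nat.card {x : CellSquare m n ε // x ∈ cellSet ε k q c} = (k + 1) * (q + 1) :=
  card_cells_seg (Nat.succ_le_of_lt hk) (Nat.succ_le_of_lt hq) hc hc'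

lemma card_eastVertex_mem_major (hk : k < m) (hq : q + 1 < n) (hc' : parity n (c.2 - q) = ε) :
    Nat.card {x : CellSquare m n ε // eastVertex hm hn x ∈ window k (q + 1) c} =
      (k + 1) * (q + 2) := by
  -- A cell lies one column to the left of its east vertex, hence the second `- 1`.
  have hw : parity n (c.2 - (q : ZMod (2 * n)) - 1 - 1) = ε := by
    rw [map_sub, map_sub _ (c.2 - (q : ZMod (2 * n))), hc', map_one]
    linear_combination - zmod_two_add_self 1
  rw [← card_cells_seg (Nat.succ_le_of_lt hk) (Nat.succ_le_of_lt hq) hc hw]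
  refine Nat.card_congr (Equiv.subtypeEquivRight fun x => ?_)
  rw [mem_window_succ_right_of_parity_eq (by rw [parity_eastVertex, hc]),
    ← add_mem_seg (z := c.2 - (q : ZMod (2 * n)) - 1)]
  rfl

lemma card_eastVertex_mem_minor (hk : k < m) (hq : q < n) (hc' : parity n (c.2 - q) = ε) :
    Nat.card {x : CellSquare m n ε // eastVertex hm hn x ∈ window (k + 1) q c} = (k + 1) * q := by
  rw [← card_cells_seg (Nat.succ_le_of_lt hk) hq.le hc
    (w := c.2 - (q : ZMod (2 * n)) + 1 - 1) (by rw [add_sub_cancel_right, hc'])]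
  refine Nat.card_congr (Equiv.subtypeEquivRight fun x => ?_)
  rw [mem_window_succ_left_of_parity_eq (by rw [parity_eastVertex, hc]), ← add_mem_seg (y := (1 : ZMod (2 * n)))]
  rfl

end Cells

/-! ### The configuration of windows and its exchange. -/

/-- White-placed windows `O_{k,q+1}` and black-placed windows `O_{q+1,k}` whose complement has a
perfect matching. The rows of the white vertices have parity `ε`. -/
structure IsWindowConfig (m n k q s : ℕ) (ε : ZMod 2) (cW cB : Fin s → TorusSquare m n) : Prop where
  k_lt_m : k < m
  k_lt_n : k < n
  q_lt_m : q + 1 < m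
  q_lt_n : q + 1 < n
  rowW : ∀ i, parity m ((cW i).1 - k) = ε
  colW : ∀ i, parity n ((cW i).2 - q) = ε
  rowB : ∀ j, parity m ((cB j).1 - q) = ε
  colB : ∀ j, parity n ((cB j).2 - k) = ε
  disjoint : Pairwise (Function.onFun Disjoint (holes k (q + 1) cW cB))
  cross : k = 0 → ∀ i j, Disjoint (board k (q + 1) (cW i)) (board (q + 1) k (cB j))
  pos : 0 < matchingsWithHoles (holes k (q + 1) cW cB)

namespace IsWindowConfig

variable {m n k q s : ℕ} {ε : ZMod 2} {cW cB : Fin s → TorusSquare m n}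
  (h : IsWindowConfig m n k q s ε cW cB)
include h

lemma m_pos : 0 < m := Nat.zero_lt_of_lt h.k_lt_m

lemma n_pos : 0 < n := Nat.zero_lt_of_lt h.k_lt_n

lemma isCellGraph : IsCellGraph (toroidalAztecRectangle m n) (colShift m n ε) (rowShift m n ε)
    (eastVertex h.m_pos h.n_pos) (southVertex h.m_pos h.n_pos) :=
  isCellGraph_toroidal _ _ (by have := h.q_lt_m; omega) (by have := h.q_lt_n; omega) ε

lemma eq_of_mem {i j : Fin s ⊕ Fin s} {v : ToroidalVertex m n}
    (hi : v ∈ holes k (q + 1) cW cB i) (hj : v ∈ holes k (q + 1) cW cB j) : i = j := by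
  by_contra hne
  exact Set.disjoint_left.1 (h.disjoint hne) hi hj

lemma cell_unique_white {x : CellSquare m n ε} {i j : Fin s} (hi : x ∈ cellSet ε k q (cW i))
    (hj : x ∈ cellSet ε k q (cW j)) : i = j :=
  Sum.inl_injective (h.eq_of_mem (i := Sum.inl i) (j := Sum.inl j)
    (cellVertex_east_mem h.m_pos h.n_pos (h.rowW i) hi true)
    (cellVertex_east_mem h.m_pos h.n_pos (h.rowW j) hj true))

lemma cell_unique_black {x : CellSquare m n ε} {i j : Fin s} (hi : x ∈ cellSet ε q k (cB i))
    (hj : x ∈ cellSet ε q k (cB j)) : i = j :=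
  Sum.inr_injective (h.eq_of_mem (i := Sum.inr i) (j := Sum.inr j)
    (cellVertex_south_mem h.m_pos h.n_pos (h.rowB i) hi true)
    (cellVertex_south_mem h.m_pos h.n_pos (h.rowB j) hj true))

/-- For `k > 0` a cell of a white block has a vertical vertex in the white window. If the cell also
lay in a black block, that vertex would be in the black window too. For `k = 0` crossing slits share
a cell but no vertex, so the crossing hypothesis is needed; the cell itself is a common square of
the two boards. -/
lemma cell_disjoint {x : CellSquare m n ε} {i j : Fin s} (hi : x ∈ cellSet ε k q (cW i)) :
    x ∉ cellSet ε q k (cB j) := by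
  intro hj
  rcases Nat.eq_zero_or_pos k with h0 | h0
  · refine Set.disjoint_left.1 (h.cross h0 i j) (?_ : x.1 ∈ _) ?_
    · obtain ⟨⟨a, ha, h1⟩, ⟨b, hb, h2⟩⟩ := hi
      refine ⟨(2 * a, 2 * b + 1), by simp only; omega, by simp only; omega, ?_⟩
      refine Prod.ext ?_ ?_
      · rw [h1]; simp only [place]; push_cast; ring
      · rw [h2]; simp only [place]; push_cast; ring
    · obtain ⟨⟨a, ha, h1⟩, ⟨b, hb, h2⟩⟩ := hj
      refine ⟨(2 * a + 1, 2 * b), by simp only; omega, by simp only; omega, ?_⟩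
      refine Prod.ext ?_ ?_
      · rw [h1]; simp only [place]; push_cast; ring
      · rw [h2]; simp only [place]; push_cast; ring
  · obtain ⟨a, ha⟩ := exists_southVertex_mem h.m_pos h.n_pos (h.rowW i) h0 hi
    have := h.eq_of_mem (i := Sum.inl i) (j := Sum.inr j) ha
      (cellVertex_south_mem h.m_pos h.n_pos (h.rowB j) hj a)
    cases this

/-- A black window contains all vertical vertices of its cells, which here are all the neighbours of
the vertex between the two cells. -/
lemma eastVertex_mem_of_black {x : CellSquare m n ε} {i j : Fin s}
    (hi : x ∈ cellSet ε q k (cB i)) (hj : colShift m n ε x ∈ cellSet ε q k (cB j)) :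
    ∃ a, eastVertex h.m_pos h.n_pos x ∈ holes k (q + 1) cW cB a :=
  Set.mem_iUnion.1 <| h.isCellGraph.mem_of_forall_notMem h.pos
    (fun b => Set.mem_iUnion.2 ⟨Sum.inr i, cellVertex_south_mem _ _ (h.rowB i) hi b⟩)
    (fun b => Set.mem_iUnion.2 ⟨Sum.inr j, cellVertex_south_mem _ _ (h.rowB j) hj b⟩)

lemma southVertex_mem_of_white {x : CellSquare m n ε} {i j : Fin s}
    (hi : x ∈ cellSet ε k q (cW i)) (hj : rowShift m n ε x ∈ cellSet ε k q (cW j)) :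
    ∃ a, southVertex h.m_pos h.n_pos x ∈ holes k (q + 1) cW cB a :=
  Set.mem_iUnion.1 <| h.isCellGraph.swap.mem_of_forall_notMem h.pos
    (fun b => Set.mem_iUnion.2 ⟨Sum.inl i, cellVertex_east_mem _ _ (h.rowW i) hi b⟩)
    (fun b => Set.mem_iUnion.2 ⟨Sum.inl j, cellVertex_east_mem _ _ (h.rowW j) hj b⟩)

/-- If both cells of a horizontally placed vertex belong to black windows, it is the same one. -/
lemma eq_black {x : CellSquare m n ε} {i j : Fin s} (hi : x ∈ cellSet ε q k (cB i))
    (hj : colShift m n ε x ∈ cellSet ε q k (cB j)) :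
    i = j ∧ eastVertex h.m_pos h.n_pos x ∈ window (q + 1) k (cB i) := by
  obtain ⟨a | a, ha⟩ := h.eastVertex_mem_of_black hi hj
  · rcases (eastVertex_mem_or _ _ (h.rowW a) x).1 ha with h1 | h1
    · exact absurd hi (h.cell_disjoint h1)
    · exact absurd hj (h.cell_disjoint h1)
  · obtain ⟨h1, h2⟩ := mem_of_eastVertex_mem _ _ (h.rowB a) x ha
    obtain rfl := h.cell_unique_black hi h1
    exact ⟨h.cell_unique_black h2 hj, ha⟩

/-- If both cells of a vertically placed vertex belong to white windows, it is the same one. -/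
lemma eq_white {x : CellSquare m n ε} {i j : Fin s} (hi : x ∈ cellSet ε k q (cW i))
    (hj : rowShift m n ε x ∈ cellSet ε k q (cW j)) :
    i = j ∧ southVertex h.m_pos h.n_pos x ∈ window k (q + 1) (cW i) := by
  obtain ⟨a | a, ha⟩ := h.southVertex_mem_of_white hi hj
  · obtain ⟨h1, h2⟩ := mem_of_southVertex_mem _ _ (h.rowW a) x ha
    obtain rfl := h.cell_unique_white hi h1
    exact ⟨h.cell_unique_white h2 hj, ha⟩
  · rcases (southVertex_mem_or _ _ (h.rowB a) x).1 ha with h1 | h1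
    · exact absurd h1 (h.cell_disjoint hi)
    · exact absurd h1 (h.cell_disjoint hj)

/-- If `m = k + 1`, the block closes up vertically, and the vertex between its last and first rows
is forced into the window. That vertex has index `k` among the rows of the smaller grid, which has
only the indices below `k`. -/
lemma succ_lt_m (i : Fin s) : k + 1 < m := by
  by_contra hlt
  obtain rfl : m = k + 1 := by have := h.k_lt_m; omega
  set y : CellSquare (k + 1) n ε := ⟨((cW i).1 - k, (cW i).2 - q), h.rowW i, h.colW i⟩ with hy
  have h0 : (2 : ZMod (2 * (k + 1))) * k + 2 = 0 := by
    have := ZMod.natCast_self (2 * (k + 1))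
    push_cast at this
    linear_combination this
  obtain ⟨x, hx⟩ := (rowShift (k + 1) n ε).surjective y
  have hx1 : x.1.1 + 2 = (cW i).1 - k := congrArg (fun z => z.1.1) hx
  have hx2 : x.1.2 = (cW i).2 - q := congrArg (fun z => z.1.2) hx
  have h1 : x ∈ cellSet ε k q (cW i) :=
    ⟨⟨k, by omega, by linear_combination hx1 - h0⟩, ⟨0, by omega, by simp [hx2]⟩⟩
  have h2 : rowShift (k + 1) n ε x ∈ cellSet ε k q (cW i) := by
    rw [hx]
    exact ⟨⟨0, by omega, by simp [hy]⟩, ⟨0, by omega, by simp [hy]⟩⟩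
  have h3 := (h.eq_white h1 h2).2
  rw [mem_window_succ_right_of_parity_ne (by rw [h.rowW]; exact parity_southVertex _ _ x)] at h3
  obtain ⟨⟨a, ha, h4⟩, -⟩ := h3
  have h5 : x.1.1 + 1 = (cW i).1 - k + 1 + 2 * a := h4
  have h6 := seg_index_unique (m := k + 1) (z := (cW i).1 - k) (a := k) (b := a) (by omega)
    (by omega) (by linear_combination h5 - hx1 + h0)
  omega

lemma succ_lt_n (i : Fin s) : k + 1 < n := by
  by_contra hlt
  obtain rfl : n = k + 1 := by have := h.k_lt_n; omega
  set y : CellSquare m (k + 1) ε := ⟨((cB i).1 - q, (cB i).2 - k), h.rowB i, h.colB i⟩ with hy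
  have h0 : (2 : ZMod (2 * (k + 1))) * k + 2 = 0 := by
    have := ZMod.natCast_self (2 * (k + 1))
    push_cast at this
    linear_combination this
  obtain ⟨x, hx⟩ := (colShift m (k + 1) ε).surjective y
  have hx1 : x.1.2 + 2 = (cB i).2 - k := congrArg (fun z => z.1.2) hx
  have hx2 : x.1.1 = (cB i).1 - q := congrArg (fun z => z.1.1) hx
  have h1 : x ∈ cellSet ε q k (cB i) :=
    ⟨⟨0, by omega, by simp [hx2]⟩, ⟨k, by omega, by linear_combination hx1 - h0⟩⟩
  have h2 : colShift m (k + 1) ε x ∈ cellSet ε q k (cB i) := by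
    rw [hx]
    exact ⟨⟨0, by omega, by simp [hy]⟩, ⟨0, by omega, by simp [hy]⟩⟩
  have h3 := (h.eq_black h1 h2).2
  rw [mem_window_succ_left_of_parity_eq (by rw [h.rowB]; exact parity_eastVertex _ _ x)] at h3
  obtain ⟨-, ⟨a, ha, h4⟩⟩ := h3
  have h5 : x.1.2 + 1 = (cB i).2 - k + 1 + 2 * a := h4
  have h6 := seg_index_unique (m := k + 1) (z := (cB i).2 - k) (a := k) (b := a) (by omega)
    (by omega) (by linear_combination h5 - hx1 + h0)
  omega

lemma isExchange_east : IsExchange (colShift m n ε) (eastVertex h.m_pos h.n_pos)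
    (fun i => cellSet ε k q (cW i)) (fun j => cellSet ε q k (cB j))
    (fun i => window k (q + 1) (cW i)) (fun j => window (q + 1) k (cB j))
    (fun i => window (k + 1) q (cW i)) (fun j => window q (k + 1) (cB j)) where
  mem₁ x i := eastVertex_mem_or _ _ (h.rowW i) x
  mem₂ x j := eastVertex_mem_and _ _ (h.rowB j) x (h.succ_lt_n j)
  mem₁' x i := eastVertex_mem_and _ _ (h.rowW i) x h.q_lt_n
  mem₂' x j := eastVertex_mem_or _ _ (h.rowB j) x
  unique₁ _ _ _ := h.cell_unique_white
  unique₂ _ _ _ := h.cell_unique_black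
  disjoint _ _ _ := h.cell_disjoint
  next₁ x i j hi hj := Sum.inl_injective (h.eq_of_mem (i := Sum.inl i) (j := Sum.inl j)
    ((eastVertex_mem_or h.m_pos h.n_pos (h.rowW i) x).2 (Or.inl hi))
    ((eastVertex_mem_or h.m_pos h.n_pos (h.rowW j) x).2 (Or.inr hj)))
  next₂ _ _ _ hi hj := (h.eq_black hi hj).1

/-- At vertical vertices the colours swap roles: the black windows have their larger grid there. -/
lemma isExchange_south : IsExchange (rowShift m n ε) (southVertex h.m_pos h.n_pos)
    (fun j => cellSet ε q k (cB j)) (fun i => cellSet ε k q (cW i))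
    (fun j => window (q + 1) k (cB j)) (fun i => window k (q + 1) (cW i))
    (fun j => window q (k + 1) (cB j)) (fun i => window (k + 1) q (cW i)) where
  mem₁ x j := southVertex_mem_or _ _ (h.rowB j) x
  mem₂ x i := southVertex_mem_and _ _ (h.rowW i) x (h.succ_lt_m i)
  mem₁' x j := southVertex_mem_and _ _ (h.rowB j) x h.q_lt_m
  mem₂' x i := southVertex_mem_or _ _ (h.rowW i) x
  unique₁ _ _ _ := h.cell_unique_black
  unique₂ _ _ _ := h.cell_unique_white
  disjoint _ _ _ hi hj := h.cell_disjoint hj hi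
  next₁ x i j hi hj := Sum.inr_injective (h.eq_of_mem (i := Sum.inr i) (j := Sum.inr j)
    ((southVertex_mem_or h.m_pos h.n_pos (h.rowB i) x).2 (Or.inl hi))
    ((southVertex_mem_or h.m_pos h.n_pos (h.rowB j) x).2 (Or.inr hj)))
  next₂ _ _ _ hi hj := (h.eq_white hi hj).1

lemma isWindow_white (i : Fin s) : IsWindow (k + 1) q (cW i) := by
  refine isWindow_of_lt h.m_pos h.n_pos (h.succ_lt_m i) (Nat.lt_of_succ_lt h.q_lt_n) ?_
  rw [h.colW, Nat.cast_succ, sub_add_eq_sub_sub, map_sub _ ((cW i).1 - (k : ZMod (2 * m))),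
    h.rowW, map_one]
  linear_combination zmod_two_add_self ε - zmod_two_add_self 1

lemma isWindow_black (j : Fin s) : IsWindow q (k + 1) (cB j) := by
  refine isWindow_of_lt h.m_pos h.n_pos (Nat.lt_of_succ_lt h.q_lt_m) (h.succ_lt_n j) ?_
  rw [h.rowB, Nat.cast_succ, sub_add_eq_sub_sub, map_sub _ ((cB j).2 - (k : ZMod (2 * n))),
    h.colB, map_one]
  linear_combination zmod_two_add_self ε - zmod_two_add_self 1

lemma pairwise_disjoint : Pairwise (Function.onFun Disjoint (holes (k + 1) q cW cB)) := by
  rintro a b hab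
  refine Set.disjoint_left.2 fun v ha hb => hab ?_
  obtain ⟨x, rfl⟩ | ⟨x, rfl⟩ := h.isCellGraph.surj v
  · rcases a with a | a <;> rcases b with b | b
    · exact congrArg _ (h.isExchange_east.eq₁ ha hb)
    · exact (h.isExchange_east.false_of_mem ha hb).elim
    · exact (h.isExchange_east.false_of_mem hb ha).elim
    · exact congrArg _ (h.isExchange_east.eq₂ ha hb)
  · rcases a with a | a <;> rcases b with b | b
    · exact congrArg _ (h.isExchange_south.eq₂ ha hb)
    · exact (h.isExchange_south.false_of_mem hb ha).elim
    · exact (h.isExchange_south.false_of_mem ha hb).elim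
    · exact congrArg _ (h.isExchange_south.eq₁ ha hb)

omit h in
lemma mem_compl_iUnion_holes {a b : ℕ} {v : ToroidalVertex m n} :
    v ∈ (⋃ i, holes a b cW cB i)ᶜ ↔
      ¬((∃ i, v ∈ window a b (cW i)) ∨ ∃ j, v ∈ window b a (cB j)) := by
  rw [Set.mem_compl_iff, Set.mem_iUnion, Sum.exists]
  rfl

/-- The cells removed from the torus. -/
def removedCells (_ : IsWindowConfig m n k q s ε cW cB) : Set (CellSquare m n ε) :=
  {x | (∃ i, x ∈ cellSet ε k q (cW i)) ∨ ∃ j, x ∈ cellSet ε q k (cB j)}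

open Classical in
lemma isComplementary : IsComplementary (colShift m n ε) (rowShift m n ε) h.removedCells
    (inSet (eastVertex h.m_pos h.n_pos) (⋃ i, holes k (q + 1) cW cB i)ᶜ)
    (inSet (southVertex h.m_pos h.n_pos) (⋃ i, holes k (q + 1) cW cB i)ᶜ)
    (inSet (eastVertex h.m_pos h.n_pos) (⋃ i, holes (k + 1) q cW cB i)ᶜ)
    (inSet (southVertex h.m_pos h.n_pos) (⋃ i, holes (k + 1) q cW cB i)ᶜ) := by
  constructor <;> intro x
  · exact h.isExchange_east.toNat_add x (inSet_eq_true.trans mem_compl_iUnion_holes)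
      (inSet_eq_true.trans mem_compl_iUnion_holes) Iff.rfl Iff.rfl
  · exact h.isExchange_south.toNat_add x
      (inSet_eq_true.trans (mem_compl_iUnion_holes.trans (by rw [or_comm])))
      (inSet_eq_true.trans (mem_compl_iUnion_holes.trans (by rw [or_comm]))) or_comm or_comm

/-- The old windows contain both horizontal vertices of each white cell and both vertical vertices
of each black one. For the new windows the two directions are interchanged. -/
lemma avoids : Avoids (colShift m n ε) (rowShift m n ε) h.removedCells
    (inSet (eastVertex h.m_pos h.n_pos) (⋃ i, holes k (q + 1) cW cB i)ᶜ)
    (inSet (southVertex h.m_pos h.n_pos) (⋃ i, holes k (q + 1) cW cB i)ᶜ) := by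
  rintro x (⟨i, hi⟩ | ⟨j, hj⟩)
  · left
    simp only [inSet_eq_false, mem_compl_iUnion_holes, not_not]
    exact ⟨Or.inl ⟨i, cellVertex_east_mem _ _ (h.rowW i) hi true⟩,
      Or.inl ⟨i, cellVertex_east_mem _ _ (h.rowW i) hi false⟩⟩
  · right
    simp only [inSet_eq_false, mem_compl_iUnion_holes, not_not]
    exact ⟨Or.inr ⟨j, cellVertex_south_mem _ _ (h.rowB j) hj true⟩,
      Or.inr ⟨j, cellVertex_south_mem _ _ (h.rowB j) hj false⟩⟩

lemma avoids' : Avoids (colShift m n ε) (rowShift m n ε) h.removedCells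
    (inSet (eastVertex h.m_pos h.n_pos) (⋃ i, holes (k + 1) q cW cB i)ᶜ)
    (inSet (southVertex h.m_pos h.n_pos) (⋃ i, holes (k + 1) q cW cB i)ᶜ) := by
  rintro x (⟨i, hi⟩ | ⟨j, hj⟩)
  · right
    simp only [inSet_eq_false, mem_compl_iUnion_holes, not_not]
    exact ⟨Or.inl ⟨i, cellVertex_south_mem _ _ (h.rowW i) hi true⟩,
      Or.inl ⟨i, cellVertex_south_mem _ _ (h.rowW i) hi false⟩⟩
  · left
    simp only [inSet_eq_false, mem_compl_iUnion_holes, not_not]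
    exact ⟨Or.inr ⟨j, cellVertex_east_mem _ _ (h.rowB j) hj true⟩,
      Or.inr ⟨j, cellVertex_east_mem _ _ (h.rowB j) hj false⟩⟩

lemma finite_cells : Finite (CellSquare m n ε) := by
  have : NeZero (2 * m) := ⟨by have := h.m_pos; omega⟩
  have : NeZero (2 * n) := ⟨by have := h.n_pos; omega⟩
  infer_instance

omit h in
lemma card_not_add {α : Type*} [Finite α] (p : α → Prop) :
    Nat.card {x // ¬p x} + Nat.card {x // p x} = Nat.card α := by
  classical
  rw [add_comm, ← Nat.card_sum]
  exact Nat.card_congr (Equiv.sumCompl p)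

lemma card_removedCells : Nat.card {x // x ∉ h.removedCells} + s * (2 * ((k + 1) * (q + 1))) =
    Nat.card (CellSquare m n ε) := by
  have := h.finite_cells
  rw [← card_not_add fun x => x ∈ h.removedCells]
  congr 1
  have e : Nat.card {x // x ∈ h.removedCells} = Nat.card {x : CellSquare m n ε //
      ∃ a : Fin s ⊕ Fin s, Sum.elim (fun i x => x ∈ cellSet ε k q (cW i))
        (fun j x => x ∈ cellSet ε q k (cB j)) a x} :=
    Nat.card_congr (Equiv.subtypeEquivRight fun x => by rw [Sum.exists]; rfl)
  rw [e, card_iUnion_of_disjoint, Fintype.sum_sum_type]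
  · have e1 : ∀ i, Nat.card {x : CellSquare m n ε // x ∈ cellSet ε k q (cW i)} =
        (k + 1) * (q + 1) := fun i =>
      card_cellSet (h.rowW i) h.k_lt_m (Nat.lt_of_succ_lt h.q_lt_n) (h.colW i)
    have e2 : ∀ j, Nat.card {x : CellSquare m n ε // x ∈ cellSet ε q k (cB j)} =
        (q + 1) * (k + 1) := fun j =>
      card_cellSet (h.rowB j) (Nat.lt_of_succ_lt h.q_lt_m) h.k_lt_n (h.colB j)
    simp only [Sum.elim_inl, Sum.elim_inr, e1, e2, Finset.sum_const, Finset.card_univ,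
      Fintype.card_fin, smul_eq_mul]
    ring
  · rintro x (i | i) (j | j) hi hj
    · exact congrArg _ (h.cell_unique_white hi hj)
    · exact absurd hj (h.cell_disjoint hi)
    · exact absurd hi (h.cell_disjoint hj)
    · exact congrArg _ (h.cell_unique_black hi hj)

lemma card_eastVertex : Nat.card {x : CellSquare m n ε //
      inSet (eastVertex h.m_pos h.n_pos) (⋃ i, holes k (q + 1) cW cB i)ᶜ x = true} +
      s * ((k + 1) * (q + 2) + (q + 1) * k) = Nat.card (CellSquare m n ε) := by
  have := h.finite_cells
  rw [← card_not_add fun x => ∃ a, eastVertex h.m_pos h.n_pos x ∈ holes k (q + 1) cW cB a]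
  congr 1
  · refine Nat.card_congr (Equiv.subtypeEquivRight fun x => ?_)
    rw [inSet_eq_true, Set.mem_compl_iff, Set.mem_iUnion]
  · rw [card_iUnion_of_disjoint
      (P := fun a x => eastVertex h.m_pos h.n_pos x ∈ holes k (q + 1) cW cB a)
      fun x i j hi hj => h.eq_of_mem hi hj, Fintype.sum_sum_type]
    have e1 : ∀ i, Nat.card {x : CellSquare m n ε //
        eastVertex h.m_pos h.n_pos x ∈ window k (q + 1) (cW i)} = (k + 1) * (q + 2) := fun i =>
      card_eastVertex_mem_major _ _ (h.rowW i) h.k_lt_m h.q_lt_n (h.colW i)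
    have e2 : ∀ j, Nat.card {x : CellSquare m n ε //
        eastVertex h.m_pos h.n_pos x ∈ window (q + 1) k (cB j)} = (q + 1) * k := fun j =>
      card_eastVertex_mem_minor _ _ (h.rowB j) (Nat.lt_of_succ_lt h.q_lt_m) h.k_lt_n (h.colB j)
    simp only [holes, Sum.elim_inl, Sum.elim_inr, e1, e2, Finset.sum_const, Finset.card_univ,
      Fintype.card_fin, smul_eq_mul]
    ring

lemma matchingsWithHoles_eq : (matchingsWithHoles (holes k (q + 1) cW cB) : ℚ) =
    2 ^ ((s : ℤ) * ((q : ℤ) - k)) * (matchingsWithHoles (holes (k + 1) q cW cB) : ℚ) := by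
  have := h.finite_cells
  have := Fintype.ofFinite (CellSquare m n ε)
  have key := card_isFilling_compl h.isComplementary h.avoids h.avoids'
  rw [← h.isCellGraph.numPerfectMatchings_eq, ← h.isCellGraph.numPerfectMatchings_eq] at key
  have hcard := h.card_removedCells.trans h.card_eastVertex.symm
  have key' := congrArg (Nat.cast : ℕ → ℚ) key
  rw [Nat.cast_mul, Nat.cast_mul, Nat.cast_pow, Nat.cast_pow] at key'
  generalize Nat.card {x // x ∉ h.removedCells} = a at hcard key'
  generalize Nat.card {x : CellSquare m n ε //
      inSet (eastVertex h.m_pos h.n_pos) (⋃ i, holes k (q + 1) cW cB i)ᶜ x = true} = b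
    at hcard key'
  -- Cells and horizontal vertices of the whole torus are equinumerous, so `b - a` is `s` times
  -- `2(k+1)(q+1) - (k+1)(q+2) - (q+1)k = q - k`.
  have hexp : (s : ℤ) * ((q : ℤ) - k) = (b : ℤ) - a := by
    have := congrArg (Nat.cast : ℕ → ℤ) hcard
    push_cast at this
    linear_combination this
  rw [hexp, zpow_sub₀ two_ne_zero, zpow_natCast, zpow_natCast, div_mul_eq_mul_div,
    eq_div_iff (pow_ne_zero _ two_ne_zero), mul_comm]
  exact key'

end IsWindowConfig

end AztecWindows

/-! ### The theorem. -/

open AztecWindows in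
theorem corollary4p3 (m n k l s : ℕ) (hm : 0 < m) (hn : 0 < n) (hl : 1 ≤ l)
    (col : (toroidalAztecRectangle m n).Coloring Bool)
    (cW cB : Fin s → TorusSquare m n)
    -- the white-placed windows of shape `O_{k,l}`, the black-placed ones of shape `O_{l,k}`
    (hW : ∀ i, IsWindow k l (cW i) ∧ WhitePlaced col (window k l (cW i)))
    (hB : ∀ j, IsWindow l k (cB j) ∧ BlackPlaced col (window l k (cB j)))
    (hdisj : Pairwise (Function.onFun Disjoint (holes k l cW cB)))
    -- diagonal slits of opposite kinds do not cross each other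
    (hcross : k = 0 → ∀ i j, Disjoint (board k l (cW i)) (board l k (cB j)))
    (hpm : 0 < matchingsWithHoles (holes k l cW cB)) :
    -- the changed windows are again disjoint odd Aztec windows
    (∀ i, IsWindow (k + 1) (l - 1) (cW i)) ∧
    (∀ j, IsWindow (l - 1) (k + 1) (cB j)) ∧
    Pairwise (Function.onFun Disjoint (holes (k + 1) (l - 1) cW cB)) ∧
    (matchingsWithHoles (holes k l cW cB) : ℚ) =
      2 ^ ((s : ℤ) * ((l : ℤ) - (k : ℤ) - 1)) *
        (matchingsWithHoles (holes (k + 1) (l - 1) cW cB) : ℚ) := by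
  obtain ⟨q, rfl⟩ : ∃ q, l = q + 1 := ⟨l - 1, by omega⟩
  rw [Nat.add_sub_cancel]
  -- Without windows nothing bounds `k` and `q` by the size of the torus, but the exponent is 0 and
  -- both sides count the matchings of the full torus.
  rcases Nat.eq_zero_or_pos s with rfl | hs
  · refine ⟨fun i => i.elim0, fun i => i.elim0, fun i => i.elim Fin.elim0 Fin.elim0, ?_⟩
    have e : holes k (q + 1) cW cB = holes (k + 1) q cW cB :=
      funext fun i => i.elim (fun i => i.elim0) fun i => i.elim0
    rw [e]
    simp
  · obtain ⟨ε, hε⟩ := exists_color_parity hm hn col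
    have rowW : ∀ i, parity m ((cW i).1 - k) = ε := fun i => (hW i).2.parity_eq hm hn hε
    have rowB : ∀ j, parity m ((cB j).1 - (q + 1 : ℕ)) = ε + 1 :=
      fun j => (hB j).2.parity_eq hm hn hε
    have h : IsWindowConfig m n k q s ε cW cB :=
      -- As `s > 0`, there is a window of each colour; the two shapes together bound `k` and `q + 1`
      -- in both directions.
      { k_lt_m := ((hW ⟨0, hs⟩).1.lt hm hn).1
        k_lt_n := ((hB ⟨0, hs⟩).1.lt hm hn).2
        q_lt_m := ((hB ⟨0, hs⟩).1.lt hm hn).1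
        q_lt_n := ((hW ⟨0, hs⟩).1.lt hm hn).2
        rowW := rowW
        colW := fun i => by
          have h1 := (hW i).1.parity_add hm hn
          rw [rowW, Nat.cast_succ, sub_add_eq_sub_sub,
            map_sub _ ((cW i).2 - (q : ZMod (2 * n))), map_one] at h1
          linear_combination h1 + zmod_two_add_self 1 - zmod_two_add_self ε
        rowB := fun j => by
          have h1 := rowB j
          rw [Nat.cast_succ, sub_add_eq_sub_sub,
            map_sub _ ((cB j).1 - (q : ZMod (2 * m))), map_one] at h1
          linear_combination h1 + zmod_two_add_self 1
        colB := fun j => by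
          have h1 := (hB j).1.parity_add hm hn
          rw [rowB] at h1
          linear_combination h1 - zmod_two_add_self ε
        disjoint := hdisj
        cross := hcross
        pos := hpm }
    refine ⟨h.isWindow_white, h.isWindow_black, h.pairwise_disjoint, ?_⟩
    have e : (((q + 1 : ℕ) : ℤ) - k - 1) = (q : ℤ) - k := by push_cast; ring
    rw [e]
    exact h.matchingsWithHoles_eq
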